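/- **Restricted partition pairs.** A partition in $(N,M)$ is a sequence of integers $0\le p_1\le p_2\le\cdots\le p_N\le M$; its weight $\mathrm{wt}(p)$ is the sum of its parts. Put $p_0=0$ and $p_{N+1}=M$. For integers $a,b,\alpha,\beta\ge 0$ with $a+b>0$, $\alpha+\beta>0$ and integers $N,M\ge0$, let $R(N,M,a,b,\alpha,\beta)=\sum q^{\mathrm{wt}(x)+\mathrm{wt}(y)}$, the sum being over all pairs $(x,y)$ of partitions in $(N,M)$ such that $y_i-x_{i+1-a}\ge 1-\alpha$ for $\max\{1,a\}\le i\le\min\{N,N+a-1\}$; $x_i-y_{i+1-b}\ge 1-\beta$ for $\max\{1,b\}\le i\le\min\{N,N+b-1\}$; if $a=0$ then $x_1\le\alpha-1$ and $y_N\ge M-\alpha+1$; if $b=0$ then $y_1\le\beta-1$ and $x_N\ge M-\beta+1$. **Gaussian polynomials.** $\left[{P\atop N}\right]=\frac{(q)_P}{(q)_N(q)_{P-N}}$ if $P\ge N\ge0$ and $0$ otherwise, where $(q)_n=\prod_{i=1}^n(1-q^i)$. **Continued fractions.** Let $s,r$ be positive coprime integers, or $s=1$, $r=0$. The continued fraction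 of $(s:r)$ is the empty sequence if $r=0$, and otherwise it is $c_1=\lfloor s/r\rfloor$ followed by the continued fraction of $(r:s-c_1r)$. In addition, $(c_1,\dots,c_m,1)$ and $(c_1,\dots,c_m+1)$, $m\ge1$, are identified. **Theorem.** Let $p$ and $p'$ be positive coprime integers and let $(p':p)$ have continued fraction $(c_1,\dots,c_{t-1},c_t+2)$ with $t\ge1$ and integers $c_1,\dots,c_t\ge0$. Let $1\le u\le t$ and $1\le d\le c_u$, and let $(s:r)$ have continued fraction $(c_1,\dots,c_{u-1},d)$. Then for all integers $N,M\ge0$, $$R(N,M,r,p-r,s,p'-s)=\sum q^{\,n_{u,d}+\sum_{k=1}^{u}\sum_{i=1}^{f_k}n_{k,i}^2+\sum_{k=u+1}^{x}\sum_{i=1}^{f_k}n_{k,i}(n_{k,i}-1)}\prod_{k=1}^{x}\prod_{i=1}^{f_k}\left[{2\bigl(w_k-\sum_{j=1}^{i}n_{k,j}\bigr)+n_{k,i-1}+n_{k,i}\atop n_{k,i-1}-n_{k,i}}\right],$$ where $(f_1,\dots,f_{t+1})=(c_1,\dots,c_{u-1},d,c_u-d,c_{u+1},\dots,c_t)$ and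 the (finite) sum is over all sequences $n^{(1)},\dots,n^{(x)}$ with $u\le x\le t+1$ of partitions $n^{(k)}=(n_{k,1},\dots,n_{k,f_k})$ with integer parts such that, for $1\le k\le x$, $n_{k,0}\ge n_{k,1}\ge\cdots\ge n_{k,f_k}\ge0$ and $\mathrm{wt}(n^{(k)})=\sum_{i=1}^{f_k}n_{k,i}\le w_k$, and moreover $\mathrm{wt}(n^{(x)})=w_x$; $\mathrm{wt}(n^{(u)})<w_u$ if $u<x$; $n_{k,f_k}>0$ if $u<k<x$; and $n_{x,f_x}=0$ if $x<t+1$. Here $$w_1=M;\quad w_k=n_{k-1,f_{k-1}}\ (2\le k\le u);\quad w_{u+1}=w_u-1-\mathrm{wt}(n^{(u)});\quad w_k=n_{k-1,f_{k-1}}-1\ (u+2\le k\le x);$$ $$n_{1,0}=N;\quad n_{k,0}=w_{k-1}-\mathrm{wt}(n^{(k-1)})\ (2\le k\le u);\quad n_{u+1,0}=n_{u,f_u}+1;\quad n_{k,0}=w_{k-1}+1-\mathrm{wt}(n^{(k-1)})\ (u+2\le k\le x).$$ (If $f_k=0$, then $n^{(k)}$ is empty and $n_{k,f_k}$ means $n_{k,0}$.)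 -/

import Mathlib

noncomputable section

namespace BurgeTree

/-! ### Restricted partition pairs -/

/-- The partitions in `(N, M)`: sequences `0 ≤ p_1 ≤ p_2 ≤ ⋯ ≤ p_N ≤ M` of integers.  The part `p_i`
is the value at the index `i - 1`. -/
def boxPartitions (N M : ℕ) : Finset (Fin N → Fin (M + 1)) :=
  open Classical in Finset.univ.filter Monotone

/-- The part `p_i` of a partition in `(N, M)`, with the boundary conventions `p_i = 0` for `i ≤ 0`
and `p_i = M` for `i > N`. -/
def boxPart {N M : ℕ} (p : Fin N → Fin (M + 1)) (i : ℤ) : ℤ :=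
  if i ≤ 0 then 0
  else if h : (i - 1).toNat < N then ((p ⟨(i - 1).toNat, h⟩ : ℕ) : ℤ)
  else (M : ℤ)

/-- The weight of a partition: the sum of its parts. -/
def boxWeight {N M : ℕ} (p : Fin N → Fin (M + 1)) : ℕ := ∑ i, (p i : ℕ)

/-- The partition pair `(x, y)` in `(N₁, M₁) × (N₂, M₂)` is restricted with respect to
`a, b, α, β`.  (`x` is the first partition of the pair, `y` the second one.) The boundary
conventions of `boxPart` matter in the last four clauses only, and only when `N₁ = N₂ = 0`. -/
structure IsRestricted {N₁ M₁ N₂ M₂ : ℕ} (a b α β : ℤ)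
    (x : Fin N₁ → Fin (M₁ + 1)) (y : Fin N₂ → Fin (M₂ + 1)) : Prop where
  first : ∀ i : ℤ, max 1 a ≤ i → i ≤ min (N₂ : ℤ) (N₁ + a - 1) →
    boxPart y i - boxPart x (i + 1 - a) ≥ 1 - α
  second : ∀ i : ℤ, max 1 b ≤ i → i ≤ min (N₁ : ℤ) (N₂ + b - 1) →
    boxPart x i - boxPart y (i + 1 - b) ≥ 1 - β
  a_zero : a = 0 → boxPart x 1 ≤ α - 1
  b_zero : b = 0 → boxPart y 1 ≤ β - 1
  a_top : a = (N₂ : ℤ) - N₁ → boxPart y N₂ ≥ M₁ - α + 1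
  b_top : b = (N₁ : ℤ) - N₂ → boxPart x N₁ ≥ M₂ - β + 1

/-- The indeterminate `q`; all identities live in the field `ℚ(q)`. -/
abbrev q : RatFunc ℚ := RatFunc.X

/-- The generating function `R(N₁, M₁, N₂, M₂, a, b, α, β)` of the restricted partition pairs. -/
def genFun₄ (N₁ M₁ N₂ M₂ : ℕ) (a b α β : ℤ) : RatFunc ℚ :=
  open Classical in
  ∑ z ∈ (boxPartitions N₁ M₁ ×ˢ boxPartitions N₂ M₂).filter
      (fun z => IsRestricted a b α β z.1 z.2),
    q ^ (boxWeight z.1 + boxWeight z.2)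

/-- `R(N, M, a, b, α, β) = R(N, M, N, M, a, b, α, β)`. -/
def genFun (N M : ℕ) (a b α β : ℤ) : RatFunc ℚ := genFun₄ N M N M a b α β

/-! ### Gaussian polynomials -/

/-- `(q)_n = (1 - q)(1 - q²)⋯(1 - qⁿ)`. -/
def qFactorial (n : ℕ) : RatFunc ℚ := ∏ i ∈ Finset.Icc 1 n, (1 - q ^ i)

/-- The Gaussian polynomial with upper entry `P` and lower entry `N`. -/
def gauss (P N : ℤ) : RatFunc ℚ :=
  if 0 ≤ N ∧ N ≤ P then
    qFactorial P.toNat / (qFactorial N.toNat * qFactorial (P - N).toNat)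
  else 0

/-! ### Continued fractions -/

/-- The continued fraction of the pair `(s : r)` by the recursive procedure; it is the empty sequence
when `r = 0`. -/
def contFrac : ℕ → ℕ → List ℕ
  | _, 0 => []
  | s, r + 1 => s / (r + 1) :: contFrac (r + 1) (s % (r + 1))
termination_by _ r => r
decreasing_by exact Nat.mod_lt _ (Nat.succ_pos _)

/-- `l` is a continued fraction of `(s : r)`, where `s, r` are positive and coprime, or `s = 1` and
`r = 0`.  The sequences `(c_1, …, c_{m-1}, c_m, 1)` and `(c_1, …, c_{m-1}, c_m + 1)` with `m ≥ 1` are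
identified. -/
def IsContFrac (l : List ℕ) (s r : ℕ) : Prop :=
  0 < s ∧ Nat.Coprime s r ∧
    (contFrac s r = l ∨ ∃ (l' : List ℕ) (e : ℕ), l = l' ++ [e, 1] ∧ contFrac s r = l' ++ [e + 1])

/-! ### Sequences of partitions -/

/-- The sequence `(f_1, …, f_{t+1}) = (c_1, …, c_{u-1}, d, c_u - d, c_{u+1}, …, c_t)`. -/
def fSeq (c : ℕ → ℕ) (u d k : ℕ) : ℕ :=
  if k < u then c k
  else if k = u then d
  else if k = u + 1 then c u - d
  else c (k - 1)

/-- For a sequence `n = (n^{(1)}, …, n^{(x)})` of partitions, written as a list of lists, the list of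
the parts of `n^{(k)}`, `1 ≤ k ≤ x`. -/
def row (n : List (List ℕ)) (k : ℕ) : List ℕ := n.getD (k - 1) []

/-- The part `n_{k,i}`, `i ≥ 1`. -/
def part (n : List (List ℕ)) (k i : ℕ) : ℤ := ((row n k).getD (i - 1) 0 : ℕ)

/-- The weight of the partition `n^{(k)}`. -/
def wt (n : List (List ℕ)) (k : ℕ) : ℤ := ((row n k).sum : ℕ)

/-- The pair `(w_k, n_{k,0})`, by recursion on `k ≥ 1` (the value at `k = 0` is not used).  In the
recursive step, `last = n_{k-1, f_{k-1}}`, which is `n_{k-1,0}` when `f_{k-1} = 0`. -/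
def bounds (f : ℕ → ℕ) (u N M : ℕ) (n : List (List ℕ)) : ℕ → ℤ × ℤ
  | 0 => (0, 0)
  | 1 => (M, N)
  | j + 2 =>
    let w : ℤ := (bounds f u N M n (j + 1)).1
    let top : ℤ := (bounds f u N M n (j + 1)).2
    let last : ℤ := if f (j + 1) = 0 then top else part n (j + 1) (f (j + 1))
    if j + 2 ≤ u then (last, w - wt n (j + 1))
    else if j + 2 = u + 1 then (w - 1 - wt n (j + 1), last + 1)
    else (last - 1, w + 1 - wt n (j + 1))

/-- The weight bound `w_k`. -/
def wBound (f : ℕ → ℕ) (u N M : ℕ) (n : List (List ℕ)) (k : ℕ) : ℤ := (bounds f u N M n k).1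

/-- The number `n_{k,i}` for `i ≥ 0`: the bound on the largest part of `n^{(k)}` if `i = 0`, and a
part of `n^{(k)}` if `i ≥ 1`. -/
def entry (f : ℕ → ℕ) (u N M : ℕ) (n : List (List ℕ)) (k i : ℕ) : ℤ :=
  if i = 0 then (bounds f u N M n k).2 else part n k i

/-- The sequences `n^{(1)}, …, n^{(x)}` of partitions over which the fermionic sum is taken;
`x` is `n.length`. -/
structure IsAdmissible (f : ℕ → ℕ) (t u N M : ℕ) (n : List (List ℕ)) : Prop where
  le_length : u ≤ n.length
  length_le : n.length ≤ t + 1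
  row_length : ∀ k, 1 ≤ k → k ≤ n.length → (row n k).length = f k
  parts : ∀ k, 1 ≤ k → k ≤ n.length → ∀ i, 1 ≤ i → i ≤ f k →
    entry f u N M n k i ≤ entry f u N M n k (i - 1)
  wt_le : ∀ k, 1 ≤ k → k ≤ n.length → wt n k ≤ wBound f u N M n k
  wt_last : wt n n.length = wBound f u N M n n.length
  wt_lt : u < n.length → wt n u < wBound f u N M n u
  pos : ∀ k, u < k → k < n.length → 0 < entry f u N M n k (f k)
  zero_last : n.length < t + 1 → entry f u N M n n.length (f n.length) = 0

/-- The exponent of `q` in the summand of the fermionic sum: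
`n_{u,d} + ∑_{k ≤ u} ∑_i n_{k,i}² + ∑_{u < k ≤ x} ∑_i n_{k,i} (n_{k,i} - 1)`. -/
def fermiExponent (f : ℕ → ℕ) (u d : ℕ) (n : List (List ℕ)) : ℤ :=
  part n u d
    + ∑ k ∈ Finset.Icc 1 u, ∑ i ∈ Finset.Icc 1 (f k), part n k i ^ 2
    + ∑ k ∈ Finset.Icc (u + 1) n.length, ∑ i ∈ Finset.Icc 1 (f k), part n k i * (part n k i - 1)

/-- The summand of the fermionic sum. -/
def fermiTerm (f : ℕ → ℕ) (u d N M : ℕ) (n : List (List ℕ)) : RatFunc ℚ :=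
  q ^ fermiExponent f u d n *
    ∏ k ∈ Finset.Icc 1 n.length, ∏ i ∈ Finset.Icc 1 (f k),
      gauss
        (2 * (wBound f u N M n k - ∑ j ∈ Finset.Icc 1 i, part n k j)
          + entry f u N M n k (i - 1) + entry f u N M n k i)
        (entry f u N M n k (i - 1) - entry f u N M n k i)

end BurgeTree

end

noncomputable section

namespace BurgeTree

/-! ### Gaussian polynomials -/

/-! The generating function of restricted pairs equals an alternating sum of products of two
Gaussian polynomials (`genFun₄_eq_boson`). Both sides satisfy the same recurrence: for partitions,
remove a largest part of `x` or a column of its box; for the sum, apply the `q`-Pascal rule to one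
factor. The induction leaves the diagonal, so the two boxes of a pair must be allowed to differ.

Two symmetries become visible on the alternating sum. The `q`-Saalschütz summation, applied to each
term, gives Burge's transformation `genFun_transform`, which trades `(α + a, β + b)` for `(α, β)` at
the cost of a sum over one part `n` with weight `q ^ (n ^ 2)` and one Gaussian polynomial.
Commutativity of the factors gives the conjugation `genFun_transpose`, which exchanges `(N, a, b)`
with `(M, α, β)`. Alternating the two runs the Euclidean algorithm on `(s : r)` and `(p' : p)`
simultaneously: a partial quotient `c` becomes a partition with `c` parts, and conjugation leads to
the next partition.

At level `u` the algorithm for `(s : r)` stops after `d` steps, at `a = 1`, `α = 0`, where the pairs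
satisfy `x_i < y_i`. Lowering `y` by one makes them weakly ordered and produces the factor `q ^
n_{u,d}` (`genFun_strict`). Weakly ordered pairs have a transformation of their own,
`orderedGenFun_transform`, with exponent `n (n - 1)`. It uses up the remaining `c_u - d` and the
later quotients, conjugation again linking consecutive partitions, down to the trivial case
`genFun_interlacing`. A summand whose `x` is smaller than `t + 1` comes from a chain that reaches an
empty box earlier.

The bookkeeping is carried by `sumsTo_ordered` and `sumsTo_genFun`, which sum over a recursive form
`Admissible` of the index set; `admissible_iff` and `fermiTerm_eq` identify it with the form in the
statement. -/

theorem q_ne_zero : q ≠ 0 := RatFunc.X_ne_zero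

theorem q_pow_ne_one {n : ℕ} (hn : n ≠ 0) : q ^ n ≠ 1 := by
  intro h
  have h1 : (algebraMap (Polynomial ℚ) (RatFunc ℚ)) (Polynomial.X ^ n) =
      algebraMap (Polynomial ℚ) (RatFunc ℚ) 1 := by
    rw [map_pow, RatFunc.algebraMap_X, map_one]; exact h
  have h2 := RatFunc.algebraMap_injective ℚ h1
  have h3 := congrArg Polynomial.natDegree h2
  rw [Polynomial.natDegree_X_pow, Polynomial.natDegree_one] at h3
  exact hn h3

theorem one_sub_q_pow_ne_zero {n : ℕ} (hn : n ≠ 0) : 1 - q ^ n ≠ 0 :=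
  sub_ne_zero.mpr (q_pow_ne_one hn).symm

theorem one_sub_q_zpow_ne_zero {n : ℤ} (hn : n ≠ 0) : 1 - q ^ n ≠ 0 := by
  rw [sub_ne_zero]
  intro h
  obtain ⟨m, rfl | rfl⟩ := n.eq_nat_or_neg
  · exact q_pow_ne_one (n := m) (by simpa using hn) (by simpa using h.symm)
  · refine q_pow_ne_one (n := m) (by simpa using hn) ?_
    rw [zpow_neg, eq_comm, inv_eq_one] at h
    simpa using h

theorem qFactorial_zero : qFactorial 0 = 1 := by simp [qFactorial]

theorem qFactorial_succ (n : ℕ) : qFactorial (n + 1) = qFactorial n * (1 - q ^ (n + 1)) := by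
  unfold qFactorial
  rw [Finset.prod_Icc_succ_top (by omega)]

theorem qFactorial_ne_zero (n : ℕ) : qFactorial n ≠ 0 :=
  Finset.prod_ne_zero_iff.mpr fun _ hi =>
    one_sub_q_pow_ne_zero (by have := (Finset.mem_Icc.mp hi).1; omega)

/-- The Gaussian polynomial counting the partitions in an `n × k` box. -/
def boxGauss (n k : ℤ) : RatFunc ℚ := gauss (n + k) n

theorem boxGauss_natCast (n k : ℕ) :
    boxGauss n k = qFactorial (n + k) / (qFactorial n * qFactorial k) := by
  unfold boxGauss gauss
  rw [if_pos (by omega), add_sub_cancel_left, Int.toNat_natCast, Int.toNat_natCast]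
  norm_cast

theorem boxGauss_of_left_neg {n : ℤ} (k : ℤ) (h : n < 0) : boxGauss n k = 0 := by
  unfold boxGauss gauss
  rw [if_neg (by omega)]

theorem boxGauss_of_right_neg (n : ℤ) {k : ℤ} (h : k < 0) : boxGauss n k = 0 := by
  unfold boxGauss gauss
  rw [if_neg (by omega)]

theorem boxGauss_ne_zero {n k : ℤ} (h : boxGauss n k ≠ 0) : 0 ≤ n ∧ 0 ≤ k := by
  constructor
  · by_contra! hn; exact h (boxGauss_of_left_neg k hn)
  · by_contra! hn; exact h (boxGauss_of_right_neg n hn)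

theorem boxGauss_comm (n k : ℤ) : boxGauss n k = boxGauss k n := by
  rcases lt_or_ge n 0 with hn | hn
  · rw [boxGauss_of_left_neg _ hn, boxGauss_of_right_neg _ hn]
  rcases lt_or_ge k 0 with hk | hk
  · rw [boxGauss_of_left_neg _ hk, boxGauss_of_right_neg _ hk]
  lift n to ℕ using hn
  lift k to ℕ using hk
  rw [boxGauss_natCast, boxGauss_natCast, add_comm, mul_comm]

theorem boxGauss_zero_right {n : ℤ} (hn : 0 ≤ n) : boxGauss n 0 = 1 := by
  lift n to ℕ using hn
  have := boxGauss_natCast n 0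
  rw [Nat.cast_zero] at this
  rw [this, qFactorial_zero, add_zero, mul_one, div_self (qFactorial_ne_zero n)]

theorem boxGauss_zero_left {n : ℤ} (hn : 0 ≤ n) : boxGauss 0 n = 1 := by
  rw [boxGauss_comm, boxGauss_zero_right hn]

/-- No range condition is needed: the left coefficient vanishes at `k = 0`, just where the Gaussian
polynomial on the right drops to zero. -/
theorem boxGauss_lower (n k : ℤ) :
    (1 - q ^ k) * boxGauss n k = (1 - q ^ (n + k)) * boxGauss n (k - 1) := by
  rcases lt_or_ge n 0 with hn | hn
  · rw [boxGauss_of_left_neg _ hn, boxGauss_of_left_neg _ hn]; simp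
  rcases lt_trichotomy k 0 with hk | rfl | hk
  · rw [boxGauss_of_right_neg _ hk, boxGauss_of_right_neg _ (by omega)]; simp
  · rw [boxGauss_of_right_neg n (k := 0 - 1) (by omega)]; simp
  lift n to ℕ using hn
  obtain ⟨m, rfl⟩ : ∃ m : ℕ, k = m + 1 := ⟨(k - 1).toNat, by omega⟩
  have e := boxGauss_natCast n (m + 1)
  push_cast at e
  rw [e, add_sub_cancel_right, boxGauss_natCast, ← add_assoc, qFactorial_succ, qFactorial_succ m]
  have e1 : q ^ ((m : ℤ) + 1) = q ^ (m + 1) := by norm_cast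
  have e2 : q ^ ((n : ℤ) + m + 1) = q ^ (n + m + 1) := by norm_cast
  have e2' : q ^ ((n : ℤ) + (m + 1)) = q ^ (n + m + 1) := by norm_cast
  rw [e1, ← add_assoc, e2]
  have h1 := one_sub_q_pow_ne_zero (n := m + 1) (by omega)
  have h2 := qFactorial_ne_zero n
  have h3 := qFactorial_ne_zero m
  field_simp

theorem boxGauss_lower_left (n k : ℤ) :
    (1 - q ^ n) * boxGauss n k = (1 - q ^ (n + k)) * boxGauss (n - 1) k := by
  rw [boxGauss_comm n, boxGauss_comm (n - 1), boxGauss_lower, add_comm]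

theorem boxGauss_shift (n k : ℤ) :
    (1 - q ^ n) * boxGauss n k = (1 - q ^ (k + 1)) * boxGauss (n - 1) (k + 1) := by
  rw [boxGauss_lower_left, boxGauss_lower, add_sub_cancel_right]
  congr 3; ring

/-- The `q`-Pascal rule. -/
theorem boxGauss_pascal {n k : ℤ} (h : ¬ (n = 0 ∧ k = 0)) :
    boxGauss n k = q ^ k * boxGauss (n - 1) k + boxGauss n (k - 1) := by
  have e1 := boxGauss_lower_left n k
  have e2 := boxGauss_lower n k
  have e3 : q ^ (n + k) = q ^ n * q ^ k := zpow_add₀ q_ne_zero _ _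
  -- The rule follows from the two contiguous relations after multiplication by `1 - q ^ (n + k)`.
  -- This factor is zero only for `n + k = 0`; as `(0, 0)` is excluded, an entry is then negative
  -- and every term vanishes.
  rcases eq_or_ne (n + k) 0 with h0 | h0
  · have : n < 0 ∨ k < 0 := by omega
    rcases this with h1 | h1
    · rw [boxGauss_of_left_neg _ h1, boxGauss_of_left_neg _ h1, boxGauss_of_left_neg _ (by omega)]
      simp
    · rw [boxGauss_of_right_neg _ h1, boxGauss_of_right_neg _ h1,
        boxGauss_of_right_neg _ (by omega)]
      simp
  · apply mul_left_cancel₀ (one_sub_q_zpow_ne_zero h0)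
    rw [mul_add, ← e2, mul_left_comm, ← e1, e3]
    ring

/-! ### The `q`-Saalschütz summation -/

/-- The certificate for a recurrence in `P`: the combination of summands that should sum to zero is
a difference of consecutive values of an explicit sequence. -/
theorem saalschuetz_telescope (P Q : ℕ) (m c i : ℤ) :
    (1 - q ^ ((P : ℤ) + 1 - c)) * (q ^ (i * (i - c)) * boxGauss i (P + 1 - i) *
        boxGauss (i - c) (Q + c - i) * boxGauss (m - i) (P + Q + 1)) -
      (1 - q ^ (m + P + 1 - c)) * (q ^ (i * (i - c)) * boxGauss i (P - i) *
        boxGauss (i - c) (Q + c - i) * boxGauss (m - i) (P + Q)) =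
    q ^ (i * (i - c) + (P + 1 - i)) * boxGauss (i - 1) (P + 1 - i) *
        ((1 - q ^ (i - c)) * boxGauss (i - c) (Q + c - i)) * boxGauss (m - i) (P + Q + 1) -
      q ^ ((i + 1) * (i + 1 - c) + (P + 1 - (i + 1))) * boxGauss i (P - i) *
        ((1 - q ^ (i + 1 - c)) * boxGauss (i + 1 - c) (Q + c - (i + 1))) *
        boxGauss (m - (i + 1)) (P + Q + 1) := by
  have hY := boxGauss_shift (i + 1 - c) (Q + c - (i + 1))
  rw [show i + 1 - c - 1 = i - c by ring, show (Q : ℤ) + c - (i + 1) + 1 = Q + c - i by ring] at hY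
  rw [hY]
  have hX1 := boxGauss_pascal (n := i) (k := P + 1 - i) (by omega)
  rw [show (P : ℤ) + 1 - i - 1 = P - i by ring] at hX1
  have hX := boxGauss_shift i (P - i)
  rw [show (P : ℤ) - i + 1 = P + 1 - i by ring] at hX
  have hZ := boxGauss_lower (m - i) (P + Q + 1)
  rw [add_sub_cancel_right] at hZ
  have hZ' := boxGauss_lower_left (m - i) (P + Q + 1)
  rw [show m - i - 1 = m - (i + 1) by ring] at hZ'
  have hPQ : (1 : RatFunc ℚ) - q ^ ((P : ℤ) + Q + 1) ≠ 0 := one_sub_q_zpow_ne_zero (by omega)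
  rw [hX1]
  generalize boxGauss (i - c) (Q + c - i) = Y at *
  generalize boxGauss i (P - i) = X at *
  generalize boxGauss (i - 1) (P + 1 - i) = X' at *
  have hZ'' : (1 - q ^ ((P : ℤ) + Q + 1)) * boxGauss (m - (i + 1)) (P + Q + 1) =
      (1 - q ^ (m - i)) * boxGauss (m - i) (P + Q) := by
    have := boxGauss_shift (m - i) (P + Q)
    rw [show m - i - 1 = m - (i + 1) by ring] at this
    rw [this]
  clear hZ' hX1 hY
  generalize boxGauss (m - (i + 1)) (P + Q + 1) = Z'' at *
  generalize boxGauss (m - i) (P + Q + 1) = Z' at *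
  generalize boxGauss (m - i) (P + Q) = Z at *
  have e1 : i * (i - c) + (P + 1 - i) = i * (i - c) + (P + 1) - i := by ring
  have e2 : (i + 1) * (i + 1 - c) + (P + 1 - (i + 1)) = i * (i - c) + (P + 1) + i - c := by ring
  have e3 : m - i + (P + Q + 1) = m + (P + 1) + Q - i := by ring
  have e4 : m + P + 1 - c = m + (P + 1) - c := by ring
  have e5 : (P : ℤ) + Q + 1 = P + 1 + Q := by ring
  rw [e1, e2]
  rw [e3, e5] at hZ
  rw [e5] at hZ'' hPQ
  rw [e4]
  generalize i * (i - c) = E at *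
  generalize (P : ℤ) + 1 = R at *
  simp only [zpow_sub₀ q_ne_zero, zpow_add₀ q_ne_zero] at *
  have hq1 : q ^ i ≠ 0 := zpow_ne_zero _ q_ne_zero
  have hq2 : q ^ c ≠ 0 := zpow_ne_zero _ q_ne_zero
  generalize q ^ i = i' at *
  generalize q ^ c = c' at *
  generalize q ^ m = m' at *
  generalize q ^ R = p at *
  generalize q ^ E = E' at *
  generalize q ^ (Q : ℤ) = Q' at *
  -- This factor turns both `Z'` and `Z''` into multiples of `Z`, so that the claim becomes a linear
  -- consequence of the contiguous relations, with the powers of `q` as free variables.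
  apply mul_left_cancel₀ hPQ
  linear_combination (norm := (field_simp; ring))
    ((1 - p / c') * E' * (p / i' * X' + X) * Y - E' * p / i' * X' * (1 - i' / c') * Y) * hZ +
    E' * p * i' / c' * X * (1 - Q' * c' / i') * Y * hZ'' -
    (p / c') * (1 - m' * p * Q' / i') * Z * Y * E' * hX

/-- The `q`-Saalschütz summation. -/
theorem saalschuetz (P Q : ℕ) (m c : ℤ) :
    ∑ i ∈ Finset.range (P + 1), q ^ ((i : ℤ) * (i - c)) * boxGauss i (P - i) *
        boxGauss (i - c) (Q + c - i) * boxGauss (m - i) (P + Q) =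
      boxGauss m (P - c) * boxGauss (m - c) (Q + c) := by
  -- The recurrence in `P` is multiplied by `1 - q ^ (P + 1 - c)`, so it gives nothing at `P + 1 =
  -- c`. There the sum has the single nonzero term `i = P + 1`; stated for all `P`, this also serves
  -- the base case `c = 0`.
  have single : ∀ P : ℕ, (P : ℤ) = c →
      ∑ i ∈ Finset.range (P + 1), q ^ ((i : ℤ) * (i - c)) * boxGauss i (P - i) *
        boxGauss (i - c) (Q + c - i) * boxGauss (m - i) (P + Q) =
      boxGauss m (P - c) * boxGauss (m - c) (Q + c) := by
    rintro P rfl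
    rw [Finset.sum_eq_single P]
    · rw [sub_self, mul_zero, zpow_zero, boxGauss_zero_right (by omega), add_sub_cancel_right,
        boxGauss_zero_left (by omega), add_comm (Q : ℤ)]
      rcases lt_or_ge m 0 with hm | hm
      · rw [boxGauss_of_left_neg (n := m - P) _ (by omega)]; simp
      · rw [boxGauss_zero_right hm]; simp
    · intro i hi hne
      rw [boxGauss_of_left_neg (n := (i : ℤ) - P)]
      · simp
      · have := Finset.mem_range.mp hi
        omega
    · intro h; simp at h
  induction P with
  | zero =>
    rcases lt_trichotomy c 0 with hc | hc | hc
    · simp only [zero_add, Finset.range_one, Finset.sum_singleton, Nat.cast_zero, zero_mul,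
        zpow_zero, sub_zero, zero_sub, one_mul, zero_add, neg_zero]
      rw [boxGauss_zero_left le_rfl, one_mul]
      rcases lt_or_ge m 0 with hm | hm
      · rw [boxGauss_of_left_neg _ hm, boxGauss_of_left_neg _ hm]; simp
      rcases lt_or_ge ((Q : ℤ) + c) 0 with hQ | hQ
      · rw [boxGauss_of_right_neg _ hQ, boxGauss_of_right_neg _ hQ]; simp
      obtain ⟨e, rfl⟩ : ∃ e : ℕ, c = -(e : ℤ) := ⟨c.natAbs, by omega⟩
      obtain ⟨r, hr⟩ : ∃ r : ℕ, (Q : ℤ) = r + e := ⟨((Q : ℤ) - e).toNat, by omega⟩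
      lift m to ℕ using hm
      rw [hr, neg_neg, add_neg_cancel_right, sub_neg_eq_add, ← Nat.cast_add, ← Nat.cast_add]
      simp only [boxGauss_natCast]
      have h1 := qFactorial_ne_zero e
      have h2 := qFactorial_ne_zero r
      have h3 := qFactorial_ne_zero m
      have h4 := qFactorial_ne_zero (m + e)
      have h5 := qFactorial_ne_zero (r + e)
      rw [show m + e + r = m + (r + e) by ring, show e + r = r + e by ring]
      field_simp
    · exact single 0 (by simp [hc])
    · rw [boxGauss_of_right_neg m (by simpa using hc), zero_mul]
      apply Finset.sum_eq_zero
      intro i hi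
      rw [boxGauss_of_left_neg (n := (i : ℤ) - c)]
      · simp
      · have := Finset.mem_range.mp hi
        omega
  | succ P ih =>
    rcases eq_or_ne ((P : ℤ) + 1 - c) 0 with h0 | h0
    · exact single (P + 1) (by push_cast; omega)
    apply mul_left_cancel₀ (one_sub_q_zpow_ne_zero h0)
    have hr := boxGauss_lower m (P + 1 - c)
    rw [show (P : ℤ) + 1 - c - 1 = P - c by ring] at hr
    push_cast
    rw [← mul_assoc, hr, mul_assoc, ← ih]
    rw [← sub_eq_zero]
    have hlast : ∑ i ∈ Finset.range (P + 1), q ^ ((i : ℤ) * (i - c)) * boxGauss i (P - i) *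
        boxGauss (i - c) (Q + c - i) * boxGauss (m - i) (P + Q) =
        ∑ i ∈ Finset.range (P + 1 + 1), q ^ ((i : ℤ) * (i - c)) * boxGauss i (P - i) *
        boxGauss (i - c) (Q + c - i) * boxGauss (m - i) (P + Q) := by
      rw [Finset.sum_range_succ _ (P + 1), boxGauss_of_right_neg _ (by push_cast; omega)]
      simp
    rw [hlast, Finset.mul_sum, Finset.mul_sum, ← Finset.sum_sub_distrib]
    let Γ : ℕ → RatFunc ℚ := fun i => q ^ ((i : ℤ) * (i - c) + (P + 1 - i)) *
      boxGauss (i - 1) (P + 1 - i) * ((1 - q ^ ((i : ℤ) - c)) * boxGauss (i - c) (Q + c - i)) *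
        boxGauss (m - i) (P + Q + 1)
    have key : ∀ i : ℕ, (1 - q ^ ((P : ℤ) + 1 - c)) * (q ^ ((i : ℤ) * (i - c)) *
        boxGauss i (P + 1 - i) * boxGauss (i - c) (Q + c - i) * boxGauss (m - i) (P + 1 + Q)) -
      (1 - q ^ (m + (P + 1 - c))) * (q ^ ((i : ℤ) * (i - c)) * boxGauss i (P - i) *
        boxGauss (i - c) (Q + c - i) * boxGauss (m - i) (P + Q)) = Γ i - Γ (i + 1) := by
      intro i
      have := saalschuetz_telescope P Q m c i
      rw [show (P : ℤ) + 1 + Q = P + Q + 1 by ring, show m + ((P : ℤ) + 1 - c) = m + P + 1 - c by ring,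
        this]
      simp only [Γ]
      push_cast
      rw [add_sub_cancel_right, show (P : ℤ) + 1 - (i + 1) = P - i by ring]
    rw [Finset.sum_congr rfl fun i _ => key i, Finset.sum_range_sub']
    simp only [Γ]
    rw [boxGauss_of_left_neg (n := ((0 : ℕ) : ℤ) - 1) _ (by simp),
      boxGauss_of_right_neg (k := (P : ℤ) + 1 - ((P + 1 + 1 : ℕ) : ℤ)) _ (by push_cast; omega)]
    simp

/-- The summation that adds one row to a product of two Gaussian polynomials. -/
theorem boxGauss_transform (N M : ℕ) (A A' : ℤ) (h : 0 ≤ A ∧ 0 ≤ A' ∨ A ≤ 0 ∧ A' ≤ 0) :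
    ∑ n ∈ Finset.range (min N M + 1), q ^ (n ^ 2) *
        gauss (2 * ((M : ℤ) - n) + N + n) ((N : ℤ) - n) *
        (boxGauss (n + A) (M - n - A') * boxGauss (n - A) (M - n + A')) =
      q ^ (A ^ 2) * (boxGauss (N + A) (M - (A' + A)) * boxGauss (N - A) (M + (A' + A))) := by
  -- These are the sums of the two entries of each `boxGauss` factor on the left, so the left side
  -- vanishes if one is negative. The right side then vanishes because `A` and `A'` have the same
  -- sign: `|A - A'| ≤ |A + A'|`.
  by_cases hPQ : 0 ≤ M + A - A' ∧ 0 ≤ M - A + A'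
  · obtain ⟨P, hP⟩ := Int.eq_ofNat_of_zero_le hPQ.1
    obtain ⟨Q, hQ⟩ := Int.eq_ofNat_of_zero_le hPQ.2
    -- The substitution is `i = n + A`, with `P + Q = 2 * M`. The index ranges need not correspond
    -- under this shift, hence the bijection between nonzero terms only.
    have hs := saalschuetz P Q (N + A) (2 * A)
    rw [show (P : ℤ) - 2 * A = M - (A' + A) by omega,
      show (Q : ℤ) + 2 * A = M + (A' + A) by omega, show (N : ℤ) + A - 2 * A = N - A by ring] at hs
    rw [← hs, Finset.mul_sum]
    have hg : ∀ n : ℤ, gauss (2 * ((M : ℤ) - n) + N + n) ((N : ℤ) - n) = boxGauss (N - n) (2 * M) := by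
      intro n
      unfold boxGauss
      congr 1
      ring
    refine Finset.sum_bij_ne_zero (fun n _ _ => (n + A).toNat) ?_ ?_ ?_ ?_
    · intro n hn hne
      have h1 := boxGauss_ne_zero (left_ne_zero_of_mul (right_ne_zero_of_mul hne))
      rw [Finset.mem_range]
      omega
    · intro n hn hne n' hn' hne' heq
      have h1 := boxGauss_ne_zero (left_ne_zero_of_mul (right_ne_zero_of_mul hne))
      have h2 := boxGauss_ne_zero (left_ne_zero_of_mul (right_ne_zero_of_mul hne'))
      omega
    · intro i hi hne
      have h1 := boxGauss_ne_zero (right_ne_zero_of_mul (right_ne_zero_of_mul hne))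
      have h2 := boxGauss_ne_zero (right_ne_zero_of_mul (left_ne_zero_of_mul
        (right_ne_zero_of_mul hne)))
      have h3 := boxGauss_ne_zero (right_ne_zero_of_mul (left_ne_zero_of_mul
        (left_ne_zero_of_mul (right_ne_zero_of_mul hne))))
      have h4 := Finset.mem_range.mp hi
      obtain ⟨n, hn⟩ := Int.eq_ofNat_of_zero_le (a := (i : ℤ) - A) (by omega)
      have hi' : (i : ℤ) = n + A := by omega
      refine ⟨n, Finset.mem_range.mpr (by omega), ?_, by omega⟩
      rw [hg]
      have e1 := left_ne_zero_of_mul (left_ne_zero_of_mul (right_ne_zero_of_mul hne))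
      have e2 := right_ne_zero_of_mul (left_ne_zero_of_mul (right_ne_zero_of_mul hne))
      have e3 := right_ne_zero_of_mul (right_ne_zero_of_mul hne)
      refine mul_ne_zero (mul_ne_zero (pow_ne_zero _ q_ne_zero) ?_) (mul_ne_zero ?_ ?_)
      · convert e3 using 2 <;> omega
      · convert right_ne_zero_of_mul e1 using 2 <;> omega
      · convert e2 using 2 <;> omega
    · intro n hn hne
      have h1 := boxGauss_ne_zero (left_ne_zero_of_mul (right_ne_zero_of_mul hne))
      have hi : (((n + A).toNat : ℕ) : ℤ) = n + A := by omega
      rw [hi, hg, ← zpow_natCast q (n ^ 2), ← mul_assoc, ← mul_assoc, ← mul_assoc, ← mul_assoc,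
        ← zpow_add₀ q_ne_zero, show A ^ 2 + ((n : ℤ) + A) * (n + A - 2 * A) = ((n ^ 2 : ℕ) : ℤ) by
          push_cast; ring,
        show (P : ℤ) - (n + A) = M - n - A' by omega, show (n : ℤ) + A - 2 * A = n - A by ring,
        show (M : ℤ) + (A' + A) - (n + A) = M - n + A' by ring,
        show (N : ℤ) + A - (n + A) = N - n by ring, show (P : ℤ) + Q = 2 * M by omega]
      ring
  · rw [Finset.sum_eq_zero]
    · symm
      by_contra hne
      have h1 := boxGauss_ne_zero (left_ne_zero_of_mul (right_ne_zero_of_mul hne))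
      have h2 := boxGauss_ne_zero (right_ne_zero_of_mul (right_ne_zero_of_mul hne))
      omega
    · intro n hn
      by_contra hne
      have h1 := boxGauss_ne_zero (left_ne_zero_of_mul (right_ne_zero_of_mul hne))
      have h2 := boxGauss_ne_zero (right_ne_zero_of_mul (right_ne_zero_of_mul hne))
      omega

/-! ### The alternating sum -/

/-- The positive summand of the alternating sum. -/
def bosonPos (N₁ M₁ N₂ M₂ a b α β l : ℤ) : RatFunc ℚ :=
  q ^ ((α + β) * (a + b) * l ^ 2 + l * (β * a - α * b) + (α + β) * l * (N₁ - N₂)) *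
    (boxGauss (N₁ + (a + b) * l) (M₁ - (α + β) * l) *
      boxGauss (N₂ - (a + b) * l) (M₂ + (α + β) * l))

/-- The negative summand of the alternating sum. -/
def bosonNeg (N₁ M₁ N₂ M₂ a b α β l : ℤ) : RatFunc ℚ :=
  q ^ (((a + b) * l - a) * ((α + β) * l - α) + ((α + β) * l - α) * (N₂ - N₁)) *
    (boxGauss (N₂ + ((a + b) * l - a)) (M₂ - ((α + β) * l - α)) *
      boxGauss (N₁ - ((a + b) * l - a)) (M₁ + ((α + β) * l - α)))

/-- The alternating sum that computes the generating function of restricted partition pairs. -/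
def boson (N₁ M₁ N₂ M₂ a b α β : ℤ) : RatFunc ℚ :=
  ∑ᶠ l : ℤ, (bosonPos N₁ M₁ N₂ M₂ a b α β l - bosonNeg N₁ M₁ N₂ M₂ a b α β l)

/-- Makes the alternating sum finite: a nonzero term requires both lower entries, which move in
opposite directions with slope `a + b`, to be nonnegative. -/
theorem abs_le_of_mul_bounds {K l A B : ℤ} (hK : 0 < K) (h1 : 0 ≤ A + K * l) (h2 : 0 ≤ B - K * l) :
    -(|A| + |B|) ≤ l ∧ l ≤ |A| + |B| := by
  have hA := abs_le.mp (le_refl |A|)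
  have hB := abs_le.mp (le_refl |B|)
  have := abs_nonneg A
  have := abs_nonneg B
  constructor
  · by_contra! h
    nlinarith
  · by_contra! h
    nlinarith

theorem finite_support_bosonPos (N₁ M₁ N₂ M₂ : ℤ) {a b : ℤ} (α β : ℤ) (hK : 0 < a + b) :
    (Function.support (bosonPos N₁ M₁ N₂ M₂ a b α β)).Finite := by
  refine (Set.finite_Icc (-(|N₁| + |N₂|)) (|N₁| + |N₂|)).subset ?_
  intro l hl
  have h1 := boxGauss_ne_zero (left_ne_zero_of_mul (right_ne_zero_of_mul hl))
  have h2 := boxGauss_ne_zero (right_ne_zero_of_mul (right_ne_zero_of_mul hl))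
  exact abs_le_of_mul_bounds hK h1.1 h2.1

theorem finite_support_bosonNeg (N₁ M₁ N₂ M₂ : ℤ) {a b : ℤ} (α β : ℤ) (hK : 0 < a + b) :
    (Function.support (bosonNeg N₁ M₁ N₂ M₂ a b α β)).Finite := by
  refine (Set.finite_Icc (-(|N₂ - a| + |N₁ + a|)) (|N₂ - a| + |N₁ + a|)).subset ?_
  intro l hl
  have h1 := boxGauss_ne_zero (left_ne_zero_of_mul (right_ne_zero_of_mul hl))
  have h2 := boxGauss_ne_zero (right_ne_zero_of_mul (right_ne_zero_of_mul hl))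
  exact abs_le_of_mul_bounds hK (by linarith) (by linarith)

theorem boson_eq_sub (N₁ M₁ N₂ M₂ : ℤ) {a b : ℤ} (α β : ℤ) (hK : 0 < a + b) :
    boson N₁ M₁ N₂ M₂ a b α β =
      ∑ᶠ l, bosonPos N₁ M₁ N₂ M₂ a b α β l - ∑ᶠ l, bosonNeg N₁ M₁ N₂ M₂ a b α β l :=
  finsum_sub_distrib (finite_support_bosonPos _ _ _ _ _ _ hK)
    (finite_support_bosonNeg _ _ _ _ _ _ hK)

theorem boson_swap (N₁ M₁ N₂ M₂ : ℤ) {a b : ℤ} (α β : ℤ) (hK : 0 < a + b) :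
    boson N₂ M₂ N₁ M₁ b a β α = boson N₁ M₁ N₂ M₂ a b α β := by
  rw [boson_eq_sub _ _ _ _ _ _ hK, boson_eq_sub _ _ _ _ _ _ (by omega)]
  congr 1
  · rw [← finsum_comp_equiv (Equiv.neg ℤ)]
    refine finsum_congr fun l => ?_
    simp only [Equiv.neg_apply, bosonPos]
    rw [mul_comm (boxGauss _ _)]
    congr 1
    · congr 1; ring
    · congr 2 <;> ring
  · rw [← finsum_comp_equiv (Equiv.subLeft (1 : ℤ))]
    refine finsum_congr fun l => ?_
    simp only [Equiv.subLeft_apply, bosonNeg]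
    rw [mul_comm (boxGauss _ _)]
    congr 1
    · congr 1; ring
    · congr 2 <;> ring

theorem boson_transpose (N₁ M₁ N₂ M₂ a b α β : ℤ) (h₁ : N₁ = N₂) (h₂ : M₁ = M₂)
    (hK : 0 < a + b) (hJ : 0 < α + β) :
    boson M₁ N₁ M₂ N₂ α β a b = boson N₁ M₁ N₂ M₂ a b α β := by
  subst h₁ h₂
  rw [boson_eq_sub _ _ _ _ _ _ hK, boson_eq_sub _ _ _ _ _ _ hJ]
  congr 1
  · rw [← finsum_comp_equiv (Equiv.neg ℤ)]
    refine finsum_congr fun l => ?_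
    simp only [Equiv.neg_apply, bosonPos]
    rw [boxGauss_comm (M₁ + _), boxGauss_comm (M₁ - _)]
    congr 1
    · congr 1; ring
    · congr 2 <;> ring
  · refine finsum_congr fun l => ?_
    simp only [bosonNeg]
    rw [boxGauss_comm (M₁ + _), boxGauss_comm (M₁ - _), mul_comm (boxGauss _ _)]
    congr 1
    congr 1; ring

/-- At this corner of the parameter region the positive and the negative term with the same `l`
coincide. -/
theorem boson_eq_zero (N M a b α β : ℤ) : boson N M (N + a) (M - α) a b α β = 0 := by
  unfold boson
  rw [finsum_eq_zero_of_forall_eq_zero]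
  intro l
  rw [sub_eq_zero]
  unfold bosonPos bosonNeg
  congr 1
  · congr 1; ring
  · congr 2 <;> ring

/-- The `q`-Pascal rule on the first factor; the term `(α + β) * l * (N₁ - N₂)` of the exponent
absorbs the shift of the power of `q`. The excluded case `(0, 0)` of the rule forces `l = 0` by
signs and yields the correction for an empty first box. -/
theorem bosonPos_rec {N₁ M₁ N₂ M₂ a b α β : ℤ} (l : ℤ) (hK : 0 < a + b) (hJ : 0 < α + β)
    (hN₁ : 0 ≤ N₁) (hM₁ : 0 ≤ M₁) :
    bosonPos N₁ M₁ N₂ M₂ a b α β l =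
      q ^ M₁ * bosonPos (N₁ - 1) M₁ N₂ M₂ a b α β l + bosonPos N₁ (M₁ - 1) N₂ M₂ a b α β l +
        if l = 0 then (if N₁ = 0 ∧ M₁ = 0 then boxGauss N₂ M₂ else 0) else 0 := by
  have hneg : ∀ k : ℤ, k < 0 → boxGauss k 0 = 0 ∧ boxGauss 0 k = 0 := fun k hk =>
    ⟨boxGauss_of_left_neg _ hk, boxGauss_of_right_neg _ hk⟩
  by_cases h0 : N₁ + (a + b) * l = 0 ∧ M₁ - (α + β) * l = 0
  · have hl : l = 0 := by
      apply le_antisymm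
      · by_contra! h; nlinarith
      · by_contra! h; nlinarith
    subst hl
    simp only [mul_zero, add_zero, sub_zero] at h0
    obtain ⟨rfl, rfl⟩ := h0
    simp [bosonPos, hneg, boxGauss_zero_left]
  · have : ¬ (l = 0 ∧ N₁ = 0 ∧ M₁ = 0) := by
      rintro ⟨rfl, rfl, rfl⟩; simp at h0
    rw [← ite_and, if_neg this, add_zero]
    unfold bosonPos
    rw [boxGauss_pascal h0, show N₁ - 1 + (a + b) * l = N₁ + (a + b) * l - 1 by ring,
      show M₁ - 1 - (α + β) * l = M₁ - (α + β) * l - 1 by ring,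
      show (α + β) * (a + b) * l ^ 2 + l * (β * a - α * b) + (α + β) * l * (N₁ - 1 - N₂) =
        ((α + β) * (a + b) * l ^ 2 + l * (β * a - α * b) + (α + β) * l * (N₁ - N₂)) +
          (M₁ - (α + β) * l) - M₁ by ring, zpow_sub₀ q_ne_zero _ M₁, zpow_add₀ q_ne_zero _ (M₁ - _)]
    have := zpow_ne_zero M₁ q_ne_zero
    field_simp

/-- Here the excluded case of the `q`-Pascal rule cannot occur: it would contradict `N₂ - N₁ < a`
for `l ≤ 0` and `M₂ - M₁ < β` for `l > 0`. -/
theorem bosonNeg_rec {N₁ M₁ N₂ M₂ a b α β : ℤ} (l : ℤ) (hK : 0 < a + b) (hJ : 0 < α + β)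
    (hN₂ : 0 ≤ N₂) (hM₂ : 0 ≤ M₂) (hN : N₂ - N₁ < a) (hM : M₂ - M₁ < β) :
    bosonNeg N₁ M₁ N₂ M₂ a b α β l =
      q ^ M₁ * bosonNeg (N₁ - 1) M₁ N₂ M₂ a b α β l + bosonNeg N₁ (M₁ - 1) N₂ M₂ a b α β l := by
  have h0 : ¬ (N₁ - ((a + b) * l - a) = 0 ∧ M₁ + ((α + β) * l - α) = 0) := by
    rintro ⟨h1, h2⟩
    rcases le_or_gt l 0 with h | h
    · nlinarith
    · nlinarith
  unfold bosonNeg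
  rw [boxGauss_pascal h0, show N₁ - 1 - ((a + b) * l - a) = N₁ - ((a + b) * l - a) - 1 by ring,
    show M₁ - 1 + ((α + β) * l - α) = M₁ + ((α + β) * l - α) - 1 by ring,
    show ((a + b) * l - a) * ((α + β) * l - α) + ((α + β) * l - α) * (N₂ - (N₁ - 1)) =
      (((a + b) * l - a) * ((α + β) * l - α) + ((α + β) * l - α) * (N₂ - N₁)) +
        (M₁ + ((α + β) * l - α)) - M₁ by ring, zpow_sub₀ q_ne_zero _ M₁,
    zpow_add₀ q_ne_zero _ (M₁ + _)]
  have := zpow_ne_zero M₁ q_ne_zero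
  field_simp

theorem boson_rec {N₁ M₁ N₂ M₂ a b α β : ℤ} (hK : 0 < a + b) (hJ : 0 < α + β)
    (hN₁ : 0 ≤ N₁) (hM₁ : 0 ≤ M₁) (hN₂ : 0 ≤ N₂) (hM₂ : 0 ≤ M₂)
    (hN : N₂ - N₁ < a) (hM : M₂ - M₁ < β) :
    boson N₁ M₁ N₂ M₂ a b α β =
      q ^ M₁ * boson (N₁ - 1) M₁ N₂ M₂ a b α β + boson N₁ (M₁ - 1) N₂ M₂ a b α β +
        if N₁ = 0 ∧ M₁ = 0 then boxGauss N₂ M₂ else 0 := by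
  have fp := fun N M => finite_support_bosonPos N M N₂ M₂ α β hK
  have fn := fun N M => finite_support_bosonNeg N M N₂ M₂ α β hK
  have fs : (Function.support fun l : ℤ =>
      if l = 0 then (if N₁ = 0 ∧ M₁ = 0 then boxGauss N₂ M₂ else 0) else 0).Finite := by
    refine (Set.finite_singleton 0).subset fun l hl => ?_
    by_contra h
    exact hl (if_neg h)
  have fm : ∀ f : ℤ → RatFunc ℚ, (Function.support f).Finite →
      (Function.support fun l => q ^ M₁ * f l).Finite := fun f hf =>
    hf.subset (Function.support_mul_subset_right _ _)
  have fa : ∀ f g : ℤ → RatFunc ℚ, (Function.support f).Finite → (Function.support g).Finite →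
      (Function.support fun l => f l + g l).Finite := fun f g hf hg =>
    (hf.union hg).subset (Function.support_add _ _)
  simp only [boson_eq_sub _ _ _ _ _ _ hK]
  rw [finsum_congr fun l => bosonPos_rec l hK hJ hN₁ hM₁,
    finsum_congr fun l => bosonNeg_rec l hK hJ hN₂ hM₂ hN hM,
    finsum_add_distrib (fa _ _ (fm _ (fp _ _)) (fp _ _)) fs,
    finsum_add_distrib (fm _ (fp _ _)) (fp _ _), finsum_add_distrib (fm _ (fn _ _)) (fn _ _),
    ← mul_finsum, ← mul_finsum,
    finsum_eq_single _ 0 (fun l hl => if_neg hl), if_pos rfl]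
  ring

/-- `boxGauss_transform` for every `l`, with `A, A'` equal to `(a + b) * l, (α + β) * l`,
respectively to these numbers reduced by `a` and `α`. Nonnegativity of the parameters gives the
equal signs, and `β * a - α * b` is unchanged by the transformation. -/
theorem boson_transform (N M : ℕ) {a b α β : ℤ} (ha : 0 ≤ a) (hb : 0 ≤ b) (hα : 0 ≤ α)
    (hβ : 0 ≤ β) (hK : 0 < a + b) :
    boson N M N M a b (α + a) (β + b) =
      ∑ n ∈ Finset.range (min N M + 1), q ^ (n ^ 2) *
        gauss (2 * ((M : ℤ) - n) + N + n) ((N : ℤ) - n) *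
        boson n (M - n) n (M - n) a b α β := by
  simp only [boson_eq_sub _ _ _ _ _ _ hK]
  rw [Finset.sum_congr rfl fun n _ => mul_sub _ _ _, Finset.sum_sub_distrib]
  have fp := fun n : ℕ => finite_support_bosonPos n (M - n) n (M - n) α β hK
  have fn := fun n : ℕ => finite_support_bosonNeg n (M - n) n (M - n) α β hK
  simp only [mul_finsum]
  rw [← finsum_sum_comm _ _ fun n _ => (fp n).subset (Function.support_mul_subset_right _ _),
    ← finsum_sum_comm _ _ fun n _ => (fn n).subset (Function.support_mul_subset_right _ _)]
  congr 1
  · refine finsum_congr fun l => ?_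
    have hs : 0 ≤ (a + b) * l ∧ 0 ≤ (α + β) * l ∨ (a + b) * l ≤ 0 ∧ (α + β) * l ≤ 0 := by
      rcases le_total 0 l with h | h
      · left; constructor <;> nlinarith
      · right; constructor <;> nlinarith
    have key := boxGauss_transform N M _ _ hs
    unfold bosonPos
    rw [show α + a + (β + b) = α + β + (a + b) by ring, add_mul (α + β) (a + b) l,
      show (α + β + (a + b)) * (a + b) * l ^ 2 + l * ((β + b) * a - (α + a) * b) +
        ((α + β) * l + (a + b) * l) * ((N : ℤ) - N) =
        ((α + β) * (a + b) * l ^ 2 + l * (β * a - α * b)) + ((a + b) * l) ^ 2 by ring,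
      zpow_add₀ q_ne_zero, mul_assoc, ← key, Finset.mul_sum]
    refine Finset.sum_congr rfl fun n _ => ?_
    rw [sub_self, mul_zero, add_zero, mul_left_comm]
  · refine finsum_congr fun l => ?_
    have hs : 0 ≤ (a + b) * l - a ∧ 0 ≤ (α + β) * l - α ∨
        (a + b) * l - a ≤ 0 ∧ (α + β) * l - α ≤ 0 := by
      rcases le_or_gt l 0 with h | h
      · right; constructor <;> nlinarith
      · left; constructor <;> nlinarith
    have key := boxGauss_transform N M _ _ hs
    unfold bosonNeg
    rw [show (α + a + (β + b)) * l - (α + a) = ((α + β) * l - α) + ((a + b) * l - a) by ring,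
      show ((a + b) * l - a) * ((α + β) * l - α + ((a + b) * l - a)) +
        ((α + β) * l - α + ((a + b) * l - a)) * ((N : ℤ) - N) =
        ((a + b) * l - a) * ((α + β) * l - α) + ((a + b) * l - a) ^ 2 by ring,
      zpow_add₀ q_ne_zero, mul_assoc, ← key, Finset.mul_sum]
    refine Finset.sum_congr rfl fun n _ => ?_
    rw [sub_self, mul_zero, add_zero, mul_left_comm]

/-! ### Recurrences for partition pairs -/

theorem mem_boxPartitions {N M : ℕ} {x : Fin N → Fin (M + 1)} :
    x ∈ boxPartitions N M ↔ Monotone x := by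
  classical
  simp [boxPartitions]

theorem boxPart_of_nonpos {N M : ℕ} (p : Fin N → Fin (M + 1)) {i : ℤ} (hi : i ≤ 0) :
    boxPart p i = 0 := if_pos hi

theorem boxPart_succ {N M : ℕ} (p : Fin N → Fin (M + 1)) (j : Fin N) :
    boxPart p ((j : ℕ) + 1) = (p j : ℕ) := by
  unfold boxPart
  rw [if_neg (by omega), dif_pos (by omega)]
  simp

theorem boxPart_of_gt {N M : ℕ} (p : Fin N → Fin (M + 1)) {i : ℤ} (hi : 0 < i) (hN : N < i) :
    boxPart p i = M := by
  unfold boxPart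
  rw [if_neg (by omega), dif_neg (by omega)]

theorem boxPart_nonneg {N M : ℕ} (p : Fin N → Fin (M + 1)) (i : ℤ) : 0 ≤ boxPart p i := by
  unfold boxPart
  split_ifs <;> omega

theorem boxPart_le {N M : ℕ} (p : Fin N → Fin (M + 1)) (i : ℤ) : boxPart p i ≤ M := by
  unfold boxPart
  split_ifs with h1 h2
  · omega
  · have := (p ⟨_, h2⟩).isLt
    omega
  · omega

/-- The index of a part of a partition, as an element of `Fin N`. -/
theorem exists_fin_of_mem {N : ℕ} {i : ℤ} (h1 : 1 ≤ i) (h2 : i ≤ N) :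
    ∃ j : Fin N, i = (j : ℕ) + 1 :=
  ⟨⟨(i - 1).toNat, by omega⟩, by simp only; omega⟩

/-- The partition with a largest possible part appended. -/
def appendTop {N M : ℕ} (x : Fin N → Fin (M + 1)) : Fin (N + 1) → Fin (M + 1) :=
  Fin.snoc (α := fun _ => Fin (M + 1)) x (Fin.last M)

/-- The partition in a box, viewed in the box with one more row. -/
def widen {N M : ℕ} (x : Fin N → Fin (M + 1)) : Fin N → Fin (M + 1 + 1) :=
  fun i => (x i).castSucc

theorem boxPart_appendTop {N M : ℕ} (x : Fin N → Fin (M + 1)) (i : ℤ) :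
    boxPart (appendTop x) i = boxPart x i := by
  rcases le_or_gt i 0 with h | h
  · rw [boxPart_of_nonpos _ h, boxPart_of_nonpos _ h]
  rcases le_or_gt i N with h' | h'
  · obtain ⟨j, rfl⟩ := exists_fin_of_mem h h'
    rw [boxPart_succ x]
    have := boxPart_succ (appendTop x) j.castSucc
    simpa [appendTop] using this
  · rw [boxPart_of_gt x h h']
    rcases eq_or_lt_of_le (show (N : ℤ) + 1 ≤ i by omega) with h2 | h2
    · rw [← h2]
      have := boxPart_succ (appendTop x) (Fin.last N)
      simpa [appendTop] using this
    · rw [boxPart_of_gt _ h (by push_cast; exact h2)]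

theorem boxPart_widen {N M : ℕ} (x : Fin N → Fin (M + 1)) {i : ℤ} (hi : i ≤ N) :
    boxPart (widen x) i = boxPart x i := by
  rcases le_or_gt i 0 with h | h
  · rw [boxPart_of_nonpos _ h, boxPart_of_nonpos _ h]
  · obtain ⟨j, rfl⟩ := exists_fin_of_mem h hi
    rw [boxPart_succ, boxPart_succ]
    simp [widen]

theorem boxWeight_appendTop {N M : ℕ} (x : Fin N → Fin (M + 1)) :
    boxWeight (appendTop x) = M + boxWeight x := by
  unfold boxWeight appendTop
  rw [Fin.sum_univ_castSucc]
  simp [add_comm]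

theorem boxWeight_widen {N M : ℕ} (x : Fin N → Fin (M + 1)) :
    boxWeight (widen x) = boxWeight x := by
  simp [boxWeight, widen]

theorem sum_boxPartitions_widen {N M : ℕ} (φ : (Fin N → Fin (M + 1 + 1)) → RatFunc ℚ) :
    ∑ x ∈ (boxPartitions N (M + 1)).filter (fun x => ∀ i, x i ≠ Fin.last _), φ x =
      ∑ x ∈ boxPartitions N M, φ (widen x) := by
  symm
  refine Finset.sum_bij (fun x _ => widen x) ?_ ?_ ?_ (fun _ _ => rfl)
  · intro x hx
    rw [Finset.mem_filter, mem_boxPartitions]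
    refine ⟨fun i j hij => ?_, fun i => (Fin.castSucc_lt_last _).ne⟩
    exact Fin.castSucc_le_castSucc_iff.mpr (mem_boxPartitions.mp hx hij)
  · intro x _ y _ h
    funext i
    exact Fin.castSucc_injective _ (congrFun h i)
  · intro y hy
    rw [Finset.mem_filter, mem_boxPartitions] at hy
    refine ⟨fun i => (y i).castPred (hy.2 i), ?_, ?_⟩
    · rw [mem_boxPartitions]
      intro i j hij
      exact hy.1 hij
    · funext i
      simp [widen]

theorem sum_boxPartitions_appendTop {N M : ℕ} (φ : (Fin (N + 1) → Fin (M + 1)) → RatFunc ℚ) :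
    ∑ x ∈ (boxPartitions (N + 1) M).filter (fun x => ¬ ∀ i, x i ≠ Fin.last _), φ x =
      ∑ x ∈ boxPartitions N M, φ (appendTop x) := by
  symm
  refine Finset.sum_bij (fun x _ => appendTop x) ?_ ?_ ?_ (fun _ _ => rfl)
  · intro x hx
    rw [Finset.mem_filter, mem_boxPartitions]
    refine ⟨?_, ?_⟩
    · intro i j hij
      induction j using Fin.lastCases with
      | last => simp [appendTop, Fin.le_last]
      | cast j =>
        induction i using Fin.lastCases with
        | last => exact absurd (lt_of_le_of_lt hij (Fin.castSucc_lt_last j)) (lt_irrefl _)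
        | cast i =>
          simp only [appendTop, Fin.snoc_castSucc]
          exact mem_boxPartitions.mp hx hij
    · push Not
      exact ⟨Fin.last N, by simp [appendTop]⟩
  · intro x _ y _ h
    funext i
    have := congrFun h i.castSucc
    simpa [appendTop] using this
  · intro y hy
    rw [Finset.mem_filter, mem_boxPartitions] at hy
    refine ⟨fun i => y i.castSucc, ?_, ?_⟩
    · rw [mem_boxPartitions]
      intro i j hij
      exact hy.1 (Fin.castSucc_le_castSucc_iff.mpr hij)
    · obtain ⟨hm, hl⟩ := hy
      push Not at hl
      obtain ⟨i, hi⟩ := hl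
      funext j
      induction j using Fin.lastCases with
      | last =>
        simp only [appendTop, Fin.snoc_last]
        exact (Fin.last_le_iff.mp (hi ▸ hm (Fin.le_last i))).symm
      | cast j => simp [appendTop]

/-- Either some part fills the width of the box, and then the last one does, or the partition fits
into a box narrower by one. -/
theorem sum_boxPartitions_succ_succ {N M : ℕ}
    (φ : (Fin (N + 1) → Fin (M + 1 + 1)) → RatFunc ℚ) :
    ∑ x ∈ boxPartitions (N + 1) (M + 1), φ x =
      ∑ x ∈ boxPartitions N (M + 1), φ (appendTop x) +
        ∑ x ∈ boxPartitions (N + 1) M, φ (widen x) := by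
  rw [← sum_boxPartitions_widen, ← sum_boxPartitions_appendTop, add_comm (Finset.sum _ φ),
    Finset.sum_filter_add_sum_filter_not]

theorem sum_boxPartitions_succ_zero {N : ℕ} (φ : (Fin (N + 1) → Fin (0 + 1)) → RatFunc ℚ) :
    ∑ x ∈ boxPartitions (N + 1) 0, φ x = ∑ x ∈ boxPartitions N 0, φ (appendTop x) := by
  rw [← sum_boxPartitions_appendTop, Finset.filter_true_of_mem]
  intro x _ h
  have : Subsingleton (Fin (0 + 1)) := inferInstanceAs (Subsingleton (Fin 1))
  exact h 0 (Subsingleton.elim _ _)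

theorem sum_boxPartitions_zero_succ {M : ℕ} (φ : (Fin 0 → Fin (M + 1 + 1)) → RatFunc ℚ) :
    ∑ x ∈ boxPartitions 0 (M + 1), φ x = ∑ x ∈ boxPartitions 0 M, φ (widen x) := by
  rw [← sum_boxPartitions_widen, Finset.filter_true_of_mem]
  intro x _ i
  exact i.elim0

theorem boxPartitions_zero_left (M : ℕ) : boxPartitions 0 M = {fun i => i.elim0} := by
  ext x
  rw [mem_boxPartitions, Finset.mem_singleton]
  exact ⟨fun _ => funext fun i => i.elim0, fun _ i => i.elim0⟩

theorem boxPartitions_zero_right (N : ℕ) : boxPartitions N 0 = {fun _ => 0} := by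
  ext x
  have : Subsingleton (Fin (0 + 1)) := inferInstanceAs (Subsingleton (Fin 1))
  rw [mem_boxPartitions, Finset.mem_singleton]
  exact ⟨fun _ => funext fun i => Subsingleton.elim _ _, fun _ _ _ _ => (Subsingleton.elim _ _).le⟩

theorem sum_q_pow_boxWeight (N M : ℕ) :
    ∑ x ∈ boxPartitions N M, q ^ boxWeight x = boxGauss N M := by
  induction hk : N + M generalizing N M with
  | zero =>
    obtain ⟨rfl, rfl⟩ : N = 0 ∧ M = 0 := by omega
    rw [boxPartitions_zero_left, Finset.sum_singleton]
    simp [boxWeight, boxGauss_zero_left]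
  | succ k ih =>
    obtain _ | N := N
    · rw [boxPartitions_zero_left, Finset.sum_singleton]
      simp [boxWeight, boxGauss_zero_left]
    obtain _ | M := M
    · rw [boxPartitions_zero_right, Finset.sum_singleton, Nat.cast_zero,
        boxGauss_zero_right (by omega)]
      simp [boxWeight]
    rw [sum_boxPartitions_succ_succ]
    simp only [boxWeight_appendTop, boxWeight_widen, pow_add]
    rw [← Finset.mul_sum, ih _ _ (by omega), ih _ _ (by omega),
      boxGauss_pascal (n := ((N + 1 : ℕ) : ℤ)) (k := ((M + 1 : ℕ) : ℤ)) (by omega)]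
    rw [show ((N + 1 : ℕ) : ℤ) - 1 = N by simp, show ((M + 1 : ℕ) : ℤ) - 1 = M by simp,
      zpow_natCast, pow_one, ← pow_succ]

/-! ### Recurrence and boundary values of the generating function of pairs -/

open Classical in
theorem genFun₄_eq (N₁ M₁ N₂ M₂ : ℕ) (a b α β : ℤ) :
    genFun₄ N₁ M₁ N₂ M₂ a b α β = ∑ x ∈ boxPartitions N₁ M₁, ∑ y ∈ boxPartitions N₂ M₂,
      if IsRestricted a b α β x y then q ^ (boxWeight x + boxWeight y) else 0 := by
  unfold genFun₄
  rw [Finset.sum_filter, Finset.sum_product]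

theorem isRestricted_swap {N₁ M₁ N₂ M₂ : ℕ} {a b α β : ℤ} {x : Fin N₁ → Fin (M₁ + 1)}
    {y : Fin N₂ → Fin (M₂ + 1)} : IsRestricted b a β α y x ↔ IsRestricted a b α β x y :=
  ⟨fun h => ⟨h.second, h.first, h.b_zero, h.a_zero, h.b_top, h.a_top⟩,
    fun h => ⟨h.second, h.first, h.b_zero, h.a_zero, h.b_top, h.a_top⟩⟩

theorem genFun₄_swap (N₁ M₁ N₂ M₂ : ℕ) (a b α β : ℤ) :
    genFun₄ N₂ M₂ N₁ M₁ b a β α = genFun₄ N₁ M₁ N₂ M₂ a b α β := by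
  classical
  rw [genFun₄_eq, genFun₄_eq, Finset.sum_comm]
  simp only [isRestricted_swap, add_comm]

/-- The condition `a_top` would require a part of `y` to be at least `M₂ + 1`. -/
theorem genFun₄_eq_zero {N₁ M₁ N₂ M₂ : ℕ} {a α : ℤ} (b β : ℤ) (hN : (N₂ : ℤ) - N₁ = a)
    (hM : (M₂ : ℤ) - M₁ = -α) : genFun₄ N₁ M₁ N₂ M₂ a b α β = 0 := by
  classical
  rw [genFun₄_eq]
  refine Finset.sum_eq_zero fun x _ => Finset.sum_eq_zero fun y _ => if_neg fun h => ?_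
  have h1 := h.a_top hN.symm
  have h2 := boxPart_le y N₂
  omega

/-- The new part `M₁` is compared with at most one part of `y` in `first`, namely `y_{N₂}` when `a =
N₂ - N₁`, and this comparison is exactly `a_top` for the shorter `x`. In `second` it satisfies its
inequality automatically because `M₂ - M₁ < β`. -/
theorem isRestricted_appendTop {N₁ M₁ N₂ M₂ : ℕ} {a b α β : ℤ} (x : Fin N₁ → Fin (M₁ + 1))
    (y : Fin N₂ → Fin (M₂ + 1)) (ha : 0 ≤ a) (hN : (N₂ : ℤ) - (N₁ + 1) < a) (hM : (M₂ : ℤ) - M₁ < β)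
    (hN' : -b ≤ (N₂ : ℤ) - (N₁ + 1)) :
    IsRestricted a b α β (appendTop x) y ↔ IsRestricted a b α β x y := by
  have htop : boxPart x (N₁ + 1) = M₁ := boxPart_of_gt _ (by omega) (by omega)
  constructor
  · intro h
    refine ⟨?_, ?_, ?_, h.b_zero, ?_, ?_⟩
    · intro i h1 h2
      have := h.first i h1 (by push_cast; omega)
      rwa [boxPart_appendTop] at this
    · intro i h1 h2
      have := h.second i h1 (by push_cast; omega)
      rwa [boxPart_appendTop] at this
    · intro ha
      have := h.a_zero ha
      rwa [boxPart_appendTop] at this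
    · intro ha
      rcases Nat.eq_zero_or_pos N₂ with h0 | h0
      · have h1 := h.a_zero (by omega)
        rw [boxPart_appendTop, show (1 : ℤ) = N₁ + 1 by omega, htop] at h1
        have := boxPart_nonneg y N₂
        omega
      · have h1 := h.first N₂ (by omega) (by push_cast; omega)
        rw [boxPart_appendTop, show (N₂ : ℤ) + 1 - a = N₁ + 1 by omega, htop] at h1
        omega
    · intro hb
      omega
  · intro h
    refine ⟨?_, ?_, ?_, h.b_zero, ?_, ?_⟩
    · intro i h1 h2
      push_cast at h2
      rw [boxPart_appendTop]
      rcases eq_or_ne i (N₁ + a) with h0 | h0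
      · have := h.a_top (by omega)
        rw [show i + 1 - a = N₁ + 1 by omega, htop, show i = N₂ by omega]
        omega
      · exact h.first i h1 (by omega)
    · intro i h1 h2
      push_cast at h2
      rw [boxPart_appendTop]
      rcases eq_or_ne i (N₁ + 1) with h0 | h0
      · rw [h0, htop]
        have := boxPart_le y (N₁ + 1 + 1 - b)
        omega
      · exact h.second i h1 (by omega)
    · intro ha
      rw [boxPart_appendTop]
      exact h.a_zero ha
    · intro ha
      push_cast at ha
      omega
    · intro hb
      rw [boxPart_appendTop]
      push_cast
      rw [htop]
      omega

/-- The width `M₁` enters only through `a_top` and the values of `boxPart` beyond the last part;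
strictness of `N₂ - N₁ < a` rules out both. -/
theorem isRestricted_widen {N₁ M₁ N₂ M₂ : ℕ} {a b α β : ℤ} (x : Fin N₁ → Fin (M₁ + 1))
    (y : Fin N₂ → Fin (M₂ + 1)) (hN : (N₂ : ℤ) - N₁ < a) :
    IsRestricted a b α β (widen x) y ↔ IsRestricted a b α β x y := by
  constructor
  · intro h
    refine ⟨?_, ?_, ?_, h.b_zero, ?_, ?_⟩
    · intro i h1 h2
      have := h.first i h1 h2
      rwa [boxPart_widen _ (by omega)] at this
    · intro i h1 h2
      have := h.second i h1 h2
      rwa [boxPart_widen _ (by omega)] at this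
    · intro ha
      have := h.a_zero ha
      rwa [boxPart_widen _ (by omega)] at this
    · intro ha
      omega
    · intro hb
      have := h.b_top hb
      rwa [boxPart_widen _ (by omega)] at this
  · intro h
    refine ⟨?_, ?_, ?_, h.b_zero, ?_, ?_⟩
    · intro i h1 h2
      rw [boxPart_widen _ (by omega)]
      exact h.first i h1 h2
    · intro i h1 h2
      rw [boxPart_widen _ (by omega)]
      exact h.second i h1 h2
    · intro ha
      rw [boxPart_widen _ (by omega)]
      exact h.a_zero ha
    · intro ha
      omega
    · intro hb
      rw [boxPart_widen _ (by omega)]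
      exact h.b_top hb

theorem genFun₄_zero_zero {N₂ M₂ : ℕ} {a b α β : ℤ} (hN : (N₂ : ℤ) < a) (hM : (M₂ : ℤ) < β) :
    genFun₄ 0 0 N₂ M₂ a b α β = boxGauss N₂ M₂ := by
  classical
  rw [genFun₄_eq, boxPartitions_zero_left, Finset.sum_singleton, ← sum_q_pow_boxWeight]
  refine Finset.sum_congr rfl fun y _ => ?_
  rw [if_pos]
  · simp [boxWeight]
  · refine ⟨?_, ?_, ?_, ?_, ?_, ?_⟩
    · intro i h1 h2
      push_cast at h2
      omega
    · intro i h1 h2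
      push_cast at h2
      omega
    · intro ha
      omega
    · intro hb
      have := boxPart_le y 1
      omega
    · intro ha
      push_cast at ha
      omega
    · intro hb
      rw [boxPart_of_nonpos _ (by simp)]
      omega

theorem genFun₄_rec {N₁ M₁ N₂ M₂ : ℕ} {a b α β : ℤ} (ha : 0 ≤ a) (hN : (N₂ : ℤ) - N₁ < a)
    (hM : (M₂ : ℤ) - M₁ < β) (hN' : -b ≤ (N₂ : ℤ) - N₁) :
    genFun₄ N₁ M₁ N₂ M₂ a b α β =
      (if N₁ = 0 then 0 else q ^ M₁ * genFun₄ (N₁ - 1) M₁ N₂ M₂ a b α β) +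
      (if M₁ = 0 then 0 else genFun₄ N₁ (M₁ - 1) N₂ M₂ a b α β) +
      if N₁ = 0 ∧ M₁ = 0 then boxGauss N₂ M₂ else 0 := by
  classical
  obtain _ | N₁ := N₁
  · obtain _ | M₁ := M₁
    · rw [genFun₄_zero_zero (by simpa using hN) (by simpa using hM)]
      simp
    · simp only [if_true, Nat.add_one_ne_zero, if_false, and_false, add_zero, zero_add,
        Nat.add_sub_cancel]
      rw [genFun₄_eq, genFun₄_eq, sum_boxPartitions_zero_succ]
      simp only [isRestricted_widen _ _ hN, boxWeight_widen]
  · push_cast at hN hN'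
    have e1 : ∑ x ∈ boxPartitions N₁ M₁, ∑ y ∈ boxPartitions N₂ M₂,
        (if IsRestricted a b α β (appendTop x) y then
          q ^ (boxWeight (appendTop x) + boxWeight y) else 0) =
        q ^ M₁ * genFun₄ N₁ M₁ N₂ M₂ a b α β := by
      rw [genFun₄_eq, Finset.mul_sum]
      refine Finset.sum_congr rfl fun x _ => ?_
      rw [Finset.mul_sum]
      refine Finset.sum_congr rfl fun y _ => ?_
      simp only [isRestricted_appendTop x y ha hN hM hN', boxWeight_appendTop, mul_ite, mul_zero,
        add_assoc, pow_add]
    simp only [Nat.add_one_ne_zero, if_false, false_and, add_zero, Nat.add_sub_cancel]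
    rw [← e1, genFun₄_eq]
    obtain _ | M₁ := M₁
    · rw [sum_boxPartitions_succ_zero]
      simp
    · rw [sum_boxPartitions_succ_succ, if_neg (by omega), Nat.add_sub_cancel,
        genFun₄_eq (N₁ + 1) M₁]
      simp only [isRestricted_widen _ _ (show (N₂ : ℤ) - ((N₁ + 1 : ℕ) : ℤ) < a by
        push_cast; exact hN), boxWeight_widen]

/-- The recurrence for `boson` refers to side `-1`, where the one for pairs has no term; each
summand is zero there. -/
theorem boson_neg_one_left {M₁ N₂ M₂ a b : ℤ} (α β : ℤ) (hb : 0 ≤ b) (hK : 0 < a + b)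
    (hN : N₂ < a) : boson (-1) M₁ N₂ M₂ a b α β = 0 := by
  refine finsum_eq_zero_of_forall_eq_zero fun l => ?_
  unfold bosonPos bosonNeg
  rcases le_or_gt l 0 with h | h
  · rw [boxGauss_of_left_neg (n := -1 + (a + b) * l) _ (by nlinarith),
      boxGauss_of_left_neg (n := N₂ + ((a + b) * l - a)) _ (by nlinarith)]
    simp
  · rw [boxGauss_of_left_neg (n := N₂ - (a + b) * l) _ (by nlinarith),
      boxGauss_of_left_neg (n := -1 - ((a + b) * l - a)) _ (by nlinarith)]
    simp

theorem boson_neg_one_right {N₁ N₂ M₂ α β : ℤ} (a b : ℤ) (hα : 0 ≤ α) (hJ : 0 < α + β)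
    (hM : M₂ < β) : boson N₁ (-1) N₂ M₂ a b α β = 0 := by
  refine finsum_eq_zero_of_forall_eq_zero fun l => ?_
  unfold bosonPos bosonNeg
  rcases lt_or_ge l 0 with h | h
  · rw [boxGauss_of_right_neg (k := M₂ + (α + β) * l) _ (by nlinarith),
      boxGauss_of_right_neg (k := -1 + ((α + β) * l - α)) _ (by nlinarith)]
    simp
  · rw [boxGauss_of_right_neg (k := -1 - (α + β) * l) _ (by nlinarith)]
    rcases eq_or_lt_of_le h with h | h
    · rw [← h, boxGauss_of_right_neg (k := -1 + ((α + β) * 0 - α)) _ (by linarith)]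
      simp
    · rw [boxGauss_of_right_neg (k := M₂ - ((α + β) * l - α)) _ (by nlinarith)]
      simp

/-- The alternating sum formula for restricted partition pairs. -/
theorem genFun₄_eq_boson (N₁ M₁ N₂ M₂ : ℕ) {a b α β : ℤ} (ha : 0 ≤ a) (hb : 0 ≤ b) (hα : 0 ≤ α)
    (hβ : 0 ≤ β) (hK : 0 < a + b) (hJ : 0 < α + β)
    (hN : (N₂ : ℤ) - N₁ ≤ a) (hN' : -b ≤ (N₂ : ℤ) - N₁)
    (hM : (M₂ : ℤ) - M₁ ≤ β) (hM' : -α ≤ (M₂ : ℤ) - M₁) :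
    genFun₄ N₁ M₁ N₂ M₂ a b α β = boson N₁ M₁ N₂ M₂ a b α β := by
  induction hk : N₁ + M₁ + N₂ + M₂ using Nat.strong_induction_on
    generalizing N₁ M₁ N₂ M₂ a b α β with
  | _ k ih =>
  have step : ∀ {N₁ M₁ N₂ M₂ : ℕ} {a b α β : ℤ}, 0 ≤ a → 0 ≤ b → 0 ≤ α → 0 ≤ β → 0 < a + b →
      0 < α + β → (N₂ : ℤ) - N₁ < a → -b ≤ (N₂ : ℤ) - N₁ → (M₂ : ℤ) - M₁ < β →
      -α ≤ (M₂ : ℤ) - M₁ → N₁ + M₁ + N₂ + M₂ = k →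
      genFun₄ N₁ M₁ N₂ M₂ a b α β = boson N₁ M₁ N₂ M₂ a b α β := by
    intro N₁ M₁ N₂ M₂ a b α β ha hb hα hβ hK hJ hN hN' hM hM' hk
    rw [genFun₄_rec ha hN hM hN',
      boson_rec hK hJ (by omega) (by omega) (by omega) (by omega) hN hM]
    congr 1
    · congr 1
      · split_ifs with h0
        · subst h0
          rw [Nat.cast_zero, zero_sub, boson_neg_one_left _ _ hb hK (by simpa using hN), mul_zero]
        · rw [ih _ _ (N₁ - 1) M₁ N₂ M₂ ha hb hα hβ hK hJ (by omega) (by omega) (by omega)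
            (by omega) rfl, zpow_natCast, Nat.cast_sub (by omega), Nat.cast_one]
          omega
      · split_ifs with h0
        · subst h0
          rw [Nat.cast_zero, zero_sub, boson_neg_one_right _ _ hα hJ (by simpa using hM)]
        · rw [ih _ _ N₁ (M₁ - 1) N₂ M₂ ha hb hα hβ hK hJ (by omega) (by omega) (by omega)
            (by omega) rfl, Nat.cast_sub (by omega), Nat.cast_one]
          omega
    · simp only [Nat.cast_eq_zero]
  -- The parameter region is a rectangle. Away from two of its sides `x` can be shortened, away from
  -- the other two `y` can. Only two opposite corners remain, and there both expressions vanish.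
  by_cases hX : (N₂ : ℤ) - N₁ < a ∧ (M₂ : ℤ) - M₁ < β
  · exact step ha hb hα hβ hK hJ hX.1 hN' hX.2 hM' hk
  by_cases hY : -b < (N₂ : ℤ) - N₁ ∧ -α < (M₂ : ℤ) - M₁
  · rw [← genFun₄_swap, ← boson_swap _ _ _ _ _ _ hK]
    exact step hb ha hβ hα (by omega) (by omega) (by omega) (by omega) (by omega) (by omega)
      (by omega)
  rcases (by omega : (N₂ : ℤ) - N₁ = a ∧ (M₂ : ℤ) - M₁ = -α ∨
    (N₁ : ℤ) - N₂ = b ∧ (M₁ : ℤ) - M₂ = -β) with h | h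
  · rw [genFun₄_eq_zero _ _ h.1 h.2, show (N₂ : ℤ) = N₁ + a by omega,
      show (M₂ : ℤ) = M₁ - α by omega, boson_eq_zero]
  · rw [← genFun₄_swap, ← boson_swap _ _ _ _ _ _ hK, genFun₄_eq_zero _ _ h.1 h.2,
      show (N₁ : ℤ) = N₂ + b by omega, show (M₁ : ℤ) = M₂ - β by omega, boson_eq_zero]

theorem genFun_eq_boson (N M : ℕ) {a b α β : ℤ} (ha : 0 ≤ a) (hb : 0 ≤ b) (hα : 0 ≤ α)
    (hβ : 0 ≤ β) (hK : 0 < a + b) (hJ : 0 < α + β) :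
    genFun N M a b α β = boson N M N M a b α β :=
  genFun₄_eq_boson N M N M ha hb hα hβ hK hJ (by omega) (by omega) (by omega) (by omega)

/-- Conjugation of both partitions of a pair. -/
theorem genFun_transpose (N M : ℕ) {a b α β : ℤ} (ha : 0 ≤ a) (hb : 0 ≤ b) (hα : 0 ≤ α)
    (hβ : 0 ≤ β) (hK : 0 < a + b) (hJ : 0 < α + β) :
    genFun N M a b α β = genFun M N α β a b := by
  rw [genFun_eq_boson _ _ ha hb hα hβ hK hJ, genFun_eq_boson _ _ hα hβ ha hb hJ hK,
    boson_transpose _ _ _ _ _ _ _ _ rfl rfl hK hJ]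

/-- Burge's transformation. -/
theorem genFun_transform (N M : ℕ) {a b α β : ℤ} (ha : 0 ≤ a) (hb : 0 ≤ b) (hα : 0 ≤ α)
    (hβ : 0 ≤ β) (hK : 0 < a + b) (hJ : 0 < α + β) :
    genFun N M a b (α + a) (β + b) =
      ∑ n ∈ Finset.range (min N M + 1), q ^ (n ^ 2) *
        gauss (2 * ((M : ℤ) - n) + N + n) ((N : ℤ) - n) * genFun n (M - n) a b α β := by
  rw [genFun_eq_boson _ _ ha hb (by omega) (by omega) hK (by omega),
    boson_transform N M ha hb hα hβ hK]
  refine Finset.sum_congr rfl fun n hn => ?_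
  have := Finset.mem_range.mp hn
  rw [genFun_eq_boson _ _ ha hb hα hβ hK hJ, Nat.cast_sub (by omega)]

/-! ### Strictly ordered partition pairs -/

/-- The partition with every part increased by one. -/
def raise {N M : ℕ} (y : Fin N → Fin (M + 1)) : Fin N → Fin (M + 1 + 1) := fun i => (y i).succ

theorem boxPart_raise {N M : ℕ} (y : Fin N → Fin (M + 1)) {i : ℤ} (hi : 1 ≤ i) :
    boxPart (raise y) i = boxPart y i + 1 := by
  rcases le_or_gt i N with h | h
  · obtain ⟨j, rfl⟩ := exists_fin_of_mem hi h
    rw [boxPart_succ, boxPart_succ]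
    simp [raise]
  · rw [boxPart_of_gt _ (by omega) h, boxPart_of_gt _ (by omega) h]
    simp

theorem boxWeight_raise {N M : ℕ} (y : Fin N → Fin (M + 1)) :
    boxWeight (raise y) = boxWeight y + N := by
  simp [boxWeight, raise, Finset.sum_add_distrib]

theorem sum_boxPartitions_raise {N M : ℕ} (φ : (Fin N → Fin (M + 1 + 1)) → RatFunc ℚ) :
    ∑ x ∈ (boxPartitions N (M + 1)).filter (fun x => ∀ i, x i ≠ 0), φ x =
      ∑ x ∈ boxPartitions N M, φ (raise x) := by
  symm
  refine Finset.sum_bij (fun x _ => raise x) ?_ ?_ ?_ (fun _ _ => rfl)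
  · intro x hx
    rw [Finset.mem_filter, mem_boxPartitions]
    refine ⟨fun i j hij => ?_, fun i => Fin.succ_ne_zero _⟩
    exact Fin.succ_le_succ_iff.mpr (mem_boxPartitions.mp hx hij)
  · intro x _ y _ h
    funext i
    exact Fin.succ_injective _ (congrFun h i)
  · intro y hy
    rw [Finset.mem_filter, mem_boxPartitions] at hy
    refine ⟨fun i => (y i).pred (hy.2 i), ?_, ?_⟩
    · rw [mem_boxPartitions]
      intro i j hij
      exact Fin.pred_le_pred_iff.mpr (hy.1 hij)
    · funext i
      simp [raise]

theorem isRestricted_widen_raise {n m : ℕ} {b β : ℤ} (x y : Fin n → Fin (m + 1)) :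
    IsRestricted 1 b 0 β (widen x) (raise y) ↔ IsRestricted 1 b 1 (β - 1) x y := by
  constructor
  · intro h
    refine ⟨?_, ?_, by omega, ?_, by omega, ?_⟩
    · intro i h1 h2
      have := h.first i h1 h2
      rw [boxPart_widen _ (by omega), boxPart_raise _ (by omega)] at this
      omega
    · intro i h1 h2
      have := h.second i h1 h2
      rw [boxPart_widen _ (by omega), boxPart_raise _ (by omega)] at this
      omega
    · intro hb
      have := h.b_zero hb
      rw [boxPart_raise _ (by omega)] at this
      omega
    · intro hb
      have := h.b_top hb
      rw [boxPart_widen _ (by omega)] at this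
      push_cast at this
      omega
  · intro h
    refine ⟨?_, ?_, by omega, ?_, by omega, ?_⟩
    · intro i h1 h2
      have := h.first i h1 h2
      rw [boxPart_widen _ (by omega), boxPart_raise _ (by omega)]
      omega
    · intro i h1 h2
      have := h.second i h1 h2
      rw [boxPart_widen _ (by omega), boxPart_raise _ (by omega)]
      omega
    · intro hb
      have := h.b_zero hb
      rw [boxPart_raise _ (by omega)]
      omega
    · intro hb
      have := h.b_top hb
      rw [boxPart_widen _ (by omega)]
      push_cast
      omega

/-- With `a = 1` and `α = 0` the pairs satisfy `x_i < y_i`. So no part of `x` is maximal and none of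
`y` is zero: the box of `x` can be narrowed and `y` lowered by one, which costs the weight `n`. -/
theorem genFun_strict (n m : ℕ) (b β : ℤ) :
    genFun n (m + 1) 1 b 0 β = q ^ n * genFun n m 1 b 1 (β - 1) := by
  classical
  have hlt : ∀ {x y : Fin n → Fin (m + 1 + 1)}, IsRestricted 1 b 0 β x y → ∀ i, x i < y i := by
    intro x y h i
    have := h.first ((i : ℕ) + 1) (by omega) (by omega)
    rw [add_sub_cancel_right, boxPart_succ, boxPart_succ] at this
    omega
  unfold genFun
  rw [genFun₄_eq, genFun₄_eq, ← Finset.sum_filter_of_ne (p := fun x => ∀ i, x i ≠ Fin.last _),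
    sum_boxPartitions_widen, Finset.mul_sum]
  · refine Finset.sum_congr rfl fun x _ => ?_
    rw [← Finset.sum_filter_of_ne (p := fun y => ∀ i, y i ≠ 0), sum_boxPartitions_raise,
      Finset.mul_sum]
    · refine Finset.sum_congr rfl fun y _ => ?_
      rw [mul_ite, mul_zero, ← pow_add, boxWeight_widen, boxWeight_raise]
      refine if_congr (isRestricted_widen_raise x y) ?_ rfl
      congr 1; ring
    · intro y _ hne i h0
      have := hlt (ite_ne_right_iff.mp hne).1 i
      rw [h0] at this
      exact absurd this (Fin.not_lt_zero _)
  · intro x _ hne i h0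
    obtain ⟨y, _, hy⟩ := Finset.exists_ne_zero_of_sum_ne_zero hne
    have := hlt (ite_ne_right_iff.mp hy).1 i
    rw [h0] at this
    exact absurd (Fin.le_last (y i)) (not_le.mpr this)

theorem genFun_zero_right (N : ℕ) (a b α β : ℤ) [Decidable (IsRestricted (N₁ := N) (M₁ := 0)
    (N₂ := N) (M₂ := 0) a b α β (fun _ => 0) (fun _ => 0))] :
    genFun N 0 a b α β = if IsRestricted (N₁ := N) (M₁ := 0) (N₂ := N) (M₂ := 0) a b α β
      (fun _ => 0) (fun _ => 0) then 1 else 0 := by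
  classical
  unfold genFun
  rw [genFun₄_eq, boxPartitions_zero_right, Finset.sum_singleton, Finset.sum_singleton]
  simp [boxWeight]

theorem boxPart_eq_zero {N : ℕ} (p : Fin N → Fin (0 + 1)) (i : ℤ) : boxPart p i = 0 :=
  le_antisymm (boxPart_le p i) (boxPart_nonneg p i)

theorem genFun_strict_zero (n : ℕ) (b : ℤ) {β : ℤ} (hβ : 0 < β) :
    genFun n 0 1 b 0 β = if n = 0 then 1 else 0 := by
  classical
  rw [genFun_zero_right]
  refine if_congr ⟨fun h => ?_, ?_⟩ rfl rfl
  · by_contra hn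
    have := h.first 1 (by omega) (by omega)
    simp only [boxPart_eq_zero] at this
    omega
  · rintro rfl
    refine ⟨?_, ?_, by omega, ?_, by omega, ?_⟩ <;> simp only [boxPart_eq_zero] <;> omega

/-- The conditions form a chain `0 ≥ y_1 ≥ x_1 ≥ y_2 ≥ ⋯ ≥ x_N ≥ M`, which is impossible unless `M =
0`. -/
theorem genFun_interlacing (N M : ℕ) : genFun N M 1 0 1 1 = if M = 0 then 1 else 0 := by
  classical
  split_ifs with h0
  · subst h0
    rw [genFun_zero_right, if_pos]
    refine ⟨?_, ?_, by omega, ?_, by omega, ?_⟩ <;> simp only [boxPart_eq_zero] <;> omega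
  · unfold genFun
    rw [genFun₄_eq]
    refine Finset.sum_eq_zero fun x _ => Finset.sum_eq_zero fun y _ => if_neg fun h => ?_
    have h1 := h.b_zero rfl
    -- For `N = 0` the contradiction comes from the convention that `y_1`, beyond the last part, is
    -- `M`.
    rcases Nat.eq_zero_or_pos N with hN | hN
    · rw [boxPart_of_gt _ (by omega) (by omega)] at h1
      omega
    have hy : ∀ k : ℕ, k < N → boxPart y ((k : ℤ) + 1) ≤ 0 := by
      intro k
      induction k with
      | zero => intro _; simpa using h1
      | succ k ih =>
        intro hk
        have e1 := h.first (k + 1) (by omega) (by omega)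
        have e2 := h.second (k + 1) (by omega) (by omega)
        have := ih (by omega)
        rw [show (k : ℤ) + 1 + 1 - 1 = k + 1 by ring] at e1
        rw [sub_zero] at e2
        push_cast
        omega
    have e1 := h.first N (by omega) (by omega)
    have e2 := h.b_top (by omega)
    have e3 := hy (N - 1) (by omega)
    rw [show ((N - 1 : ℕ) : ℤ) + 1 = N by omega] at e3
    rw [add_sub_cancel_right] at e1
    omega

/-- The generating function of the weakly ordered pairs in the box with one row less, completed by
its value for an empty box. -/
def orderedGenFun (P P' : ℤ) (n m : ℕ) : RatFunc ℚ :=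
  if n = 0 then (if m = 0 then 1 else 0) else genFun (n - 1) m 1 (P - 1) 1 (P' - 1)

theorem genFun_strict_eq (P P' : ℤ) (hP' : 0 < P') (n m : ℕ) :
    genFun n m 1 (P - 1) 0 P' =
      if m = 0 then (if n = 0 then 1 else 0) else q ^ n * orderedGenFun P P' (n + 1) (m - 1) := by
  obtain _ | m := m
  · rw [genFun_strict_zero _ _ hP', if_pos rfl]
  · rw [genFun_strict, if_neg (by omega), orderedGenFun, if_neg (by omega)]
    rfl

/-- Burge's transformation ends in strictly ordered pairs, which `genFun_strict_eq` makes weakly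
ordered again. The exponent becomes `n ^ 2 + n = (n + 1) * n`; the shift built into `orderedGenFun`
renames `n + 1` as `n`. Its value at `n = 0` accounts for the strict pairs in a box of width zero.
-/
theorem orderedGenFun_transform {P P' : ℤ} (hP : 0 < P) (hP' : 0 < P') (N M : ℕ) :
    orderedGenFun P (P' + P) N M =
      ∑ n ∈ Finset.range (min N M + 1), q ^ ((n : ℤ) * (n - 1)) *
        gauss (2 * ((M : ℤ) - n) + N + n) ((N : ℤ) - n) * orderedGenFun P P' n (M - n) := by
  have h0 : gauss (2 * (M : ℤ) + N) N = boxGauss N (2 * M) := by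
    unfold boxGauss; rw [add_comm]
  rw [Finset.sum_range_succ']
  simp only [Nat.cast_zero, zero_mul, zpow_zero, sub_zero, add_zero, one_mul, Nat.sub_zero]
  obtain _ | N := N
  · simp only [Nat.zero_min, Finset.range_zero, Finset.sum_empty, zero_add, Nat.cast_zero,
      orderedGenFun, if_true]
    rw [show (2 * (M : ℤ) + 0) = 0 + 2 * M by ring]
    change _ = boxGauss 0 (2 * M) * _
    rw [boxGauss_zero_left (by omega), one_mul]
  conv_lhs => rw [orderedGenFun, if_neg (Nat.succ_ne_zero N), Nat.add_sub_cancel,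
    show (1 : ℤ) = 0 + 1 by ring, show P' + P - (0 + 1) = P' + (P - 1) by ring, zero_add]
  have ht := genFun_transform N M (a := 1) (b := P - 1) (α := 0) (β := P') (by omega) (by omega)
    (by omega) (by omega) (by omega) (by omega)
  rw [zero_add] at ht
  rw [ht, h0]
  simp only [genFun_strict_eq P P' hP']
  obtain _ | M := M
  · simp only [Nat.min_zero, Finset.range_zero, Finset.sum_empty, zero_add, Finset.range_one,
      Finset.sum_singleton, orderedGenFun, if_true, Nat.cast_zero, mul_zero, sub_zero, add_zero]
    rw [boxGauss_zero_right (by omega), show gauss (N : ℤ) N = boxGauss N 0 by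
      unfold boxGauss; rw [add_zero], boxGauss_zero_right (by omega)]
    simp
  · rw [show min (N + 1) (M + 1) = min N M + 1 by omega, orderedGenFun, if_pos rfl,
      if_neg (Nat.succ_ne_zero M), mul_zero, add_zero]
    symm
    -- The only index that may be dropped is `n = M + 1`: the remaining box has width zero and
    -- positive height, so it carries no strict pair.
    rw [← Finset.sum_subset (Finset.range_subset_range.mpr
      (show min N M + 1 ≤ min N (M + 1) + 1 by omega))]
    · refine Finset.sum_congr rfl fun n hn => ?_
      have := Finset.mem_range.mp hn
      have e1 : q ^ (((n + 1 : ℕ) : ℤ) * (((n + 1 : ℕ) : ℤ) - 1)) = q ^ n ^ 2 * q ^ n := by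
        rw [← pow_add, ← zpow_natCast]
        congr 1
        push_cast
        ring
      have e2 : gauss (2 * (((M + 1 : ℕ) : ℤ) - ((n + 1 : ℕ) : ℤ)) + ((N + 1 : ℕ) : ℤ) +
          ((n + 1 : ℕ) : ℤ)) (((N + 1 : ℕ) : ℤ) - ((n + 1 : ℕ) : ℤ)) =
          gauss (2 * (((M + 1 : ℕ) : ℤ) - n) + N + n) ((N : ℤ) - n) := by
        congr 1 <;> push_cast <;> ring
      rw [if_neg (by omega), e1, e2, Nat.sub_sub]
      ring
    · intro n hn hn'
      rw [Finset.mem_range] at hn hn'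
      rw [if_pos (by omega), if_neg (by omega), mul_zero]

/-! ### Finite sums over sets of lists -/

/-- The set `S` is finite, and the sum of `F` over `S` is `v`. -/
def SumsTo {α : Type*} (S : Set α) (F : α → RatFunc ℚ) (v : RatFunc ℚ) : Prop :=
  S.Finite ∧ ∑ᶠ x ∈ S, F x = v

theorem sumsTo_empty {α : Type*} (F : α → RatFunc ℚ) : SumsTo ∅ F 0 :=
  ⟨Set.finite_empty, finsum_mem_empty⟩

theorem sumsTo_singleton {α : Type*} (F : α → RatFunc ℚ) (a : α) : SumsTo {a} F (F a) :=
  ⟨Set.finite_singleton a, finsum_mem_singleton⟩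

theorem sumsTo_finset {α : Type*} (s : Finset α) (F : α → RatFunc ℚ) :
    SumsTo (s : Set α) F (∑ x ∈ s, F x) :=
  ⟨s.finite_toSet, finsum_mem_coe_finset _ _⟩

theorem SumsTo.mul_left {α : Type*} {S : Set α} {F : α → RatFunc ℚ} {v : RatFunc ℚ}
    (h : SumsTo S F v) (c : RatFunc ℚ) : SumsTo S (fun x => c * F x) (c * v) :=
  ⟨h.1, by rw [← h.2, mul_finsum_mem]⟩

/-- Summation over lists by their first entry. -/
theorem SumsTo.cons {α : Type*} {R : Set α} {T : α → Set (List α)} {S : Set (List α)}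
    {F : List α → RatFunc ℚ} {H : α → List α → RatFunc ℚ} {c w : α → RatFunc ℚ} {v : RatFunc ℚ}
    (hR : SumsTo R (fun a => c a * w a) v) (hT : ∀ a ∈ R, SumsTo (T a) (H a) (w a))
    (hS : ∀ l, l ∈ S ↔ ∃ a ∈ R, ∃ l' ∈ T a, l = a :: l')
    (hF : ∀ a ∈ R, ∀ l' ∈ T a, F (a :: l') = c a * H a l') : SumsTo S F v := by
  have hS' : S = ⋃ a ∈ R, List.cons a '' T a := by
    ext l
    rw [hS]
    simp only [Set.mem_iUnion, Set.mem_image, exists_prop]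
    exact exists_congr fun a => and_congr_right fun _ => exists_congr fun l' =>
      and_congr_right fun _ => eq_comm
  have hfin : ∀ a ∈ R, (List.cons a '' T a).Finite := fun a ha => (hT a ha).1.image _
  refine ⟨hS' ▸ hR.1.biUnion hfin, ?_⟩
  rw [hS', finsum_mem_biUnion _ hR.1 hfin, ← hR.2]
  · refine finsum_mem_congr rfl fun a ha => ?_
    rw [finsum_mem_image (List.cons_injective.injOn), ← (hT a ha).2, mul_finsum_mem]
    exact finsum_mem_congr rfl fun l' hl' => hF a ha l' hl'
  · intro a _ b _ hab
    rw [Function.onFun, Set.disjoint_left]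
    rintro _ ⟨l, _, rfl⟩ ⟨l', _, h⟩
    exact hab (List.cons.inj h).1.symm

/-! ### Rows -/

/-- `l` is a weakly decreasing list with entries at most `N` and sum at most `M`. -/
def IsRow : ℕ → ℕ → List ℕ → Prop
  | _, _, [] => True
  | N, M, n :: l => n ≤ N ∧ n ≤ M ∧ IsRow n (M - n) l

/-- The last entry of the list `N :: l`. -/
def rowLast : ℕ → List ℕ → ℕ
  | N, [] => N
  | _, n :: l => rowLast n l

/-- The contribution of a row to the summand of the fermionic sum. -/
def rowTerm (e : ℤ → ℤ) : ℕ → ℕ → List ℕ → RatFunc ℚ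
  | _, _, [] => 1
  | N, M, n :: l => q ^ e n * gauss (2 * ((M : ℤ) - n) + N + n) ((N : ℤ) - n) *
      rowTerm e n (M - n) l

theorem IsRow.sum_le {N M : ℕ} {l : List ℕ} (h : IsRow N M l) : l.sum ≤ M := by
  induction l generalizing N M with
  | nil => simp
  | cons n l ih =>
    have := ih h.2.2
    have := h.2.1
    rw [List.sum_cons]
    omega

/-- A transformation iterated `f` times is one sum over rows of length `f`: each chosen part bounds
the next one and is subtracted from the available weight. -/
theorem sumsTo_rows {e : ℤ → ℤ} {W : ℕ → ℕ → ℕ → RatFunc ℚ}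
    (hW : ∀ j N M, W (j + 1) N M = ∑ n ∈ Finset.range (min N M + 1), q ^ e n *
      gauss (2 * ((M : ℤ) - n) + N + n) ((N : ℤ) - n) * W j n (M - n)) (f N M : ℕ) :
    SumsTo {l | l.length = f ∧ IsRow N M l}
      (fun l => rowTerm e N M l * W 0 (rowLast N l) (M - l.sum)) (W f N M) := by
  induction f generalizing N M with
  | zero =>
    have : {l : List ℕ | l.length = 0 ∧ IsRow N M l} = {[]} := by
      ext l
      simp only [Set.mem_ofPred_eq, List.length_eq_zero_iff, Set.mem_singleton_iff]
      exact ⟨fun h => h.1, fun h => ⟨h, h ▸ trivial⟩⟩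
    rw [this]
    convert sumsTo_singleton _ _ using 1
    simp [rowTerm, rowLast]
  | succ f ih =>
    rw [hW]
    refine (sumsTo_finset _ _).cons (fun n _ => ih n (M - n)) ?_ ?_
    · rintro (_ | ⟨n, l⟩)
      · simp
      · simp only [Set.mem_ofPred_eq, List.length_cons, IsRow, Finset.coe_range, Set.mem_Iio]
        constructor
        · rintro ⟨h1, h2, h3, h4⟩
          exact ⟨n, by omega, l, ⟨by omega, h4⟩, rfl⟩
        · rintro ⟨n', h1, l', h2, h3⟩
          obtain ⟨rfl, rfl⟩ := List.cons.inj h3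
          exact ⟨by omega, by omega, by omega, h2.2⟩
    · intro n _ l _
      simp only [rowTerm, rowLast, List.sum_cons, Nat.sub_sub, mul_assoc]

/-! ### Recursive description of the sequences of partitions -/

/-- The bound on the parts of the second partition. -/
def nextTop (u M : ℕ) (N : ℕ) (l : List ℕ) : ℕ :=
  if u = 0 then M + 1 - l.sum else if u = 1 then rowLast N l + 1 else M - l.sum

/-- The bound on the weight of the second partition. -/
def nextWeight (u M : ℕ) (N : ℕ) (l : List ℕ) : ℕ :=
  if u = 0 then rowLast N l - 1 else if u = 1 then M - 1 - l.sum else rowLast N l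

/-- The admissible sequences, by recursion on the sequence. -/
def Admissible : (ℕ → ℕ) → ℕ → ℕ → ℕ → ℕ → List (List ℕ) → Prop
  | _, _, _, _, _, [] => False
  | f, t, u, N, M, l :: n =>
    l.length = f 1 ∧ IsRow N M l ∧
      ((n = [] ∧ u ≤ 1 ∧ l.sum = M ∧ (0 < t → rowLast N l = 0)) ∨
        (0 < t ∧ (u = 1 → l.sum < M) ∧ (u = 0 → 0 < rowLast N l) ∧
          Admissible (fun k => f (k + 1)) (t - 1) (u - 1) (nextTop u M N l) (nextWeight u M N l) n))

/-- The exponent of a part, depending on whether its partition is among the first `u`. -/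
def stepExp (u : ℕ) (n : ℤ) : ℤ := if u = 0 then n * (n - 1) else n ^ 2

/-- The summand of the fermionic sum, by recursion on the sequence. -/
def admissibleTerm : ℕ → ℕ → ℕ → List (List ℕ) → RatFunc ℚ
  | _, _, _, [] => 1
  | u, N, M, l :: n =>
    (if u = 1 then q ^ rowLast N l else 1) * rowTerm (stepExp u) N M l *
      admissibleTerm (u - 1) (nextTop u M N l) (nextWeight u M N l) n

/-- The pair of integers with continued fraction `(f_1, …, f_t, f_{t+1} + 2)`. -/
def tailFrac : (ℕ → ℕ) → ℕ → ℕ × ℕ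
  | f, 0 => (f 1 + 2, 1)
  | f, t + 1 =>
    (f 1 * (tailFrac (fun k => f (k + 1)) t).1 + (tailFrac (fun k => f (k + 1)) t).2,
      (tailFrac (fun k => f (k + 1)) t).1)

theorem tailFrac_pos (f : ℕ → ℕ) (t : ℕ) : 0 < (tailFrac f t).1 ∧ 0 < (tailFrac f t).2 := by
  induction t generalizing f with
  | zero => simp [tailFrac]
  | succ t ih =>
    have := ih fun k => f (k + 1)
    simp only [tailFrac]
    omega

theorem sumsTo_ordered_rows {P P' : ℤ} (hP : 0 < P) (hP' : 0 < P') (f N M : ℕ) :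
    SumsTo {l | l.length = f ∧ IsRow N M l}
      (fun l => rowTerm (stepExp 0) N M l * orderedGenFun P P' (rowLast N l) (M - l.sum))
      (orderedGenFun P (f * P + P') N M) := by
  have := sumsTo_rows (e := stepExp 0) (W := fun j N M => orderedGenFun P (j * P + P') N M)
    (fun j N M => by
      have := orderedGenFun_transform hP (P' := j * P + P') (by positivity) N M
      rw [show ((j + 1 : ℕ) : ℤ) * P + P' = j * P + P' + P by push_cast; ring, this]
      rfl) f N M
  simpa using this

/-- Induction on the number of partial quotients. After the `f 1` transformations of the first row,
either the box is empty and the chain ends, or conjugation exchanges the two entries of the fraction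
and the next row begins. -/
theorem sumsTo_ordered (f : ℕ → ℕ) (t N M : ℕ) :
    SumsTo {n | Admissible f t 0 N M n} (admissibleTerm 0 N M)
      (orderedGenFun (tailFrac f t).2 (tailFrac f t).1 N M) := by
  induction t generalizing f N M with
  | zero =>
    have hR := sumsTo_ordered_rows (P := 1) (P' := 2) (by omega) (by omega) (f 1) N M
    have : (((tailFrac f 0).1 : ℕ) : ℤ) = f 1 * 1 + 2 := by simp [tailFrac]
    rw [this]
    refine SumsTo.cons (T := fun l => {n | n = [] ∧ l.sum = M}) (H := fun _ _ => 1) hR ?_ ?_ ?_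
    · intro l hl
      have hle := hl.2.sum_le
      have hv : orderedGenFun 1 2 (rowLast N l) (M - l.sum) = if l.sum = M then 1 else 0 := by
        have : (M - l.sum = 0) = (l.sum = M) := by rw [eq_iff_iff]; omega
        unfold orderedGenFun
        norm_num only
        rw [genFun_interlacing]
        simp only [this, ite_self]
      rw [hv]
      split_ifs with h
      · convert sumsTo_singleton (fun _ : List (List ℕ) => (1 : RatFunc ℚ)) [] using 1
        ext n
        simp [h]
      · convert sumsTo_empty _ using 1
        ext n
        simp [h]
    · rintro (_ | ⟨l, n⟩)
      · simp [Admissible]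
      · simp only [Set.mem_ofPred_eq, Admissible]
        constructor
        · rintro ⟨h1, h2, ⟨h3, -, h4, -⟩ | ⟨h3, -⟩⟩
          · exact ⟨l, ⟨h1, h2⟩, n, ⟨h3, h4⟩, rfl⟩
          · omega
        · rintro ⟨l', h1, n', h2, h3⟩
          obtain ⟨rfl, rfl⟩ := List.cons.inj h3
          exact ⟨h1.1, h1.2, Or.inl ⟨h2.1, by omega, h2.2, by omega⟩⟩
    · rintro l _ n ⟨rfl, _⟩
      simp [admissibleTerm]
  | succ t ih =>
    obtain ⟨hp1, hp2⟩ := tailFrac_pos (fun k => f (k + 1)) t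
    set P := (tailFrac (fun k => f (k + 1)) t).1 with hP
    set P' := (tailFrac (fun k => f (k + 1)) t).2 with hP'
    have hR := sumsTo_ordered_rows (P := P) (P' := P') (by omega) (by omega) (f 1) N M
    have e : (((tailFrac f (t + 1)).1 : ℕ) : ℤ) = f 1 * P + P' := by
      simp only [tailFrac, ← hP, ← hP']; push_cast; ring
    have e' : (tailFrac f (t + 1)).2 = P := rfl
    rw [e, e']
    refine SumsTo.cons (T := fun l => {n | (n = [] ∧ l.sum = M ∧ rowLast N l = 0) ∨
      (0 < rowLast N l ∧ Admissible (fun k => f (k + 1)) t 0 (nextTop 0 M N l)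
        (nextWeight 0 M N l) n)})
      (H := fun l => admissibleTerm 0 (nextTop 0 M N l) (nextWeight 0 M N l)) hR ?_ ?_ ?_
    · intro l hl
      have hle := hl.2.sum_le
      -- A last part equal to zero ends the sequence, and the completed value of `orderedGenFun`
      -- enforces that the whole weight is used. Otherwise the shift by one in `orderedGenFun`
      -- changes sides under conjugation, whence the bounds `M + 1 - l.sum` and `rowLast N l - 1`.
      rcases Nat.eq_zero_or_pos (rowLast N l) with h0 | h0
      · have hv : orderedGenFun P P' (rowLast N l) (M - l.sum) = if l.sum = M then 1 else 0 := by
          rw [orderedGenFun, if_pos h0]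
          exact if_congr (by omega) rfl rfl
        rw [hv]
        split_ifs with h
        · convert sumsTo_singleton _ ([] : List (List ℕ)) using 1
          · ext n
            simp [h, h0]
          · simp [admissibleTerm]
        · convert sumsTo_empty _ using 1
          ext n
          simp [h, h0]
      · have := ih (fun k => f (k + 1)) (nextTop 0 M N l) (nextWeight 0 M N l)
        convert this using 1
        · ext n
          simp [h0, h0.ne']
        · simp only [nextTop, nextWeight, if_true, ← hP, ← hP']
          rw [orderedGenFun, if_neg h0.ne', orderedGenFun, if_neg (by omega),
            genFun_transpose _ _ (by omega) (by omega) (by omega) (by omega) (by omega) (by omega),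
            show M + 1 - l.sum - 1 = M - l.sum by omega]
    · rintro (_ | ⟨l, n⟩)
      · simp [Admissible]
      · simp only [Set.mem_ofPred_eq, Admissible]
        constructor
        · rintro ⟨h1, h2, ⟨h3, -, h4, h5⟩ | ⟨-, -, h3, h4⟩⟩
          · exact ⟨l, ⟨h1, h2⟩, n, Or.inl ⟨h3, h4, h5 (by omega)⟩, rfl⟩
          · exact ⟨l, ⟨h1, h2⟩, n, Or.inr ⟨h3 trivial, h4⟩, rfl⟩
        · rintro ⟨l', h1, n', h2, h3⟩
          obtain ⟨rfl, rfl⟩ := List.cons.inj h3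
          refine ⟨h1.1, h1.2, ?_⟩
          rcases h2 with h2 | h2
          · exact Or.inl ⟨h2.1, by omega, h2.2.1, fun _ => h2.2.2⟩
          · exact Or.inr ⟨by omega, by omega, fun _ => h2.1, h2.2⟩
    · intro l _ n _
      simp [admissibleTerm]

/-- The pair of integers with continued fraction `(f_1, …, f_u)`. -/
def headFrac : (ℕ → ℕ) → ℕ → ℕ × ℕ
  | _, 0 => (1, 0)
  | f, u + 1 =>
    (f 1 * (headFrac (fun k => f (k + 1)) u).1 + (headFrac (fun k => f (k + 1)) u).2,
      (headFrac (fun k => f (k + 1)) u).1)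

/-- The pair of integers with continued fraction
`(f_1, …, f_{u-1}, f_u + f_{u+1}, f_{u+2}, …, f_t, f_{t+1} + 2)`. -/
def fullFrac : (ℕ → ℕ) → ℕ → ℕ → ℕ × ℕ
  | f, t, 0 => ((tailFrac f t).2, (tailFrac f t).1)
  | f, t, 1 =>
    (f 1 * (tailFrac (fun k => f (k + 1)) (t - 1)).2 + (tailFrac (fun k => f (k + 1)) (t - 1)).1,
      (tailFrac (fun k => f (k + 1)) (t - 1)).2)
  | f, t, u + 2 =>
    (f 1 * (fullFrac (fun k => f (k + 1)) (t - 1) (u + 1)).1 +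
        (fullFrac (fun k => f (k + 1)) (t - 1) (u + 1)).2,
      (fullFrac (fun k => f (k + 1)) (t - 1) (u + 1)).1)

/-- Supplies `r ≤ p` and `s ≤ p'` at every level, hence the nonnegativity of `b` and `β` that
transformation and conjugation require. -/
theorem headFrac_le_fullFrac (f : ℕ → ℕ) (t u : ℕ) :
    (headFrac f (u + 1)).1 ≤ (fullFrac f t (u + 1)).1 ∧
      (headFrac f (u + 1)).2 ≤ (fullFrac f t (u + 1)).2 ∧
      0 < (fullFrac f t (u + 1)).1 ∧ 0 < (fullFrac f t (u + 1)).2 := by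
  induction u generalizing f t with
  | zero =>
    have := tailFrac_pos (fun k => f (k + 1)) (t - 1)
    simp only [headFrac, fullFrac]
    refine ⟨?_, ?_, ?_, ?_⟩
    · nlinarith
    · omega
    · omega
    · omega
  | succ u ih =>
    obtain ⟨h1, h2, h3, h4⟩ := ih (fun k => f (k + 1)) (t - 1)
    rw [headFrac]
    simp only [fullFrac]
    refine ⟨?_, h1, by omega, h3⟩
    have := Nat.mul_le_mul_left (f 1) h1
    omega

theorem sumsTo_genFun_rows {a b α β : ℤ} (ha : 0 ≤ a) (hb : 0 ≤ b) (hα : 0 ≤ α)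
    (hβ : 0 ≤ β) (hK : 0 < a + b) (hJ : 0 < α + β) {u : ℕ} (hu : u ≠ 0) (f N M : ℕ) :
    SumsTo {l | l.length = f ∧ IsRow N M l}
      (fun l => rowTerm (stepExp u) N M l * genFun (rowLast N l) (M - l.sum) a b α β)
      (genFun N M a b (f * a + α) (f * b + β)) := by
  have := sumsTo_rows (e := stepExp u) (W := fun j N M => genFun N M a b (j * a + α) (j * b + β))
    (fun j N M => by
      have h1 : 0 ≤ (j : ℤ) * a := by positivity
      have h2 : 0 ≤ (j : ℤ) * b := by positivity
      have := genFun_transform N M ha hb (α := j * a + α) (β := j * b + β) (by omega) (by omega) hK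
        (by omega)
      rw [show ((j + 1 : ℕ) : ℤ) * a + α = j * a + α + a by push_cast; ring,
        show ((j + 1 : ℕ) : ℤ) * b + β = j * b + β + b by push_cast; ring, this]
      refine Finset.sum_congr rfl fun n _ => ?_
      rw [stepExp, if_neg hu]
      norm_cast) f N M
  simpa using this

/-- Before the last of the first `u` rows both fractions lose the same partial quotient and
conjugation follows. The last of these rows ends at strictly ordered pairs, and `sumsTo_ordered`
takes over without conjugation, because the next row continues the same partial quotient. -/
theorem sumsTo_genFun (f : ℕ → ℕ) (t u N M : ℕ) (hut : u < t) :
    SumsTo {n | Admissible f t (u + 1) N M n} (admissibleTerm (u + 1) N M)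
      (genFun N M (headFrac f (u + 1)).2 ((fullFrac f t (u + 1)).2 - (headFrac f (u + 1)).2)
        (headFrac f (u + 1)).1 ((fullFrac f t (u + 1)).1 - (headFrac f (u + 1)).1)) := by
  induction u generalizing f t N M with
  | zero =>
    obtain ⟨hp1, hp2⟩ := tailFrac_pos (fun k => f (k + 1)) (t - 1)
    have hR := sumsTo_genFun_rows (a := 1) (b := (tailFrac (fun k => f (k + 1)) (t - 1)).2 - 1)
      (α := 0) (β := (tailFrac (fun k => f (k + 1)) (t - 1)).1) (by omega) (by omega) (by omega)
      (by omega) (by omega) (by omega) (u := 1) (by omega) (f 1) N M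
    have ih := sumsTo_ordered (fun k => f (k + 1)) (t - 1)
    simp only [headFrac, fullFrac, zero_add]
    set P := (tailFrac (fun k => f (k + 1)) (t - 1)).2 with hP
    set P' := (tailFrac (fun k => f (k + 1)) (t - 1)).1 with hP'
    rw [show (((f 1 * P + P' : ℕ) : ℤ) - ((f 1 * 1 + 0 : ℕ) : ℤ)) = f 1 * ((P : ℤ) - 1) + P' by
      push_cast; ring, show ((f 1 * 1 + 0 : ℕ) : ℤ) = f 1 * 1 + 0 by push_cast; ring, Nat.cast_one]
    refine SumsTo.cons (T := fun l => {n | (n = [] ∧ l.sum = M ∧ rowLast N l = 0) ∨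
      (l.sum < M ∧ Admissible (fun k => f (k + 1)) (t - 1) 0 (nextTop 1 M N l)
        (nextWeight 1 M N l) n)})
      (H := fun l n => q ^ rowLast N l *
        admissibleTerm 0 (nextTop 1 M N l) (nextWeight 1 M N l) n) hR ?_ ?_ ?_
    · intro l hl
      have hle := hl.2.sum_le
      rw [genFun_strict_eq _ _ (by omega)]
      -- Strict pairs in a box of width zero exist only at height zero, so the sequence stops there;
      -- for positive width, passing to weak order lowers the width by one and `orderedGenFun`
      -- raises the height index by one.
      rcases eq_or_lt_of_le hle with h0 | h0
      · rw [if_pos (by omega)]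
        split_ifs with h
        · convert sumsTo_singleton _ ([] : List (List ℕ)) using 1
          · ext n
            simp [h, h0]
          · simp [admissibleTerm, h]
        · convert sumsTo_empty _ using 1
          ext n
          simp [h, h0]
      · rw [if_neg (by omega)]
        have := (ih (nextTop 1 M N l) (nextWeight 1 M N l)).mul_left (q ^ rowLast N l)
        convert this using 1
        · ext n
          simp [h0, h0.ne]
        · simp only [nextTop, nextWeight, one_ne_zero, if_false, if_true]
          rw [show M - 1 - l.sum = M - l.sum - 1 by omega]
    · rintro (_ | ⟨l, n⟩)
      · simp [Admissible]
      · simp only [Set.mem_ofPred_eq, Admissible]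
        constructor
        · rintro ⟨h1, h2, ⟨h3, -, h4, h5⟩ | ⟨-, h3, -, h4⟩⟩
          · exact ⟨l, ⟨h1, h2⟩, n, Or.inl ⟨h3, h4, h5 (by omega)⟩, rfl⟩
          · exact ⟨l, ⟨h1, h2⟩, n, Or.inr ⟨h3 trivial, h4⟩, rfl⟩
        · rintro ⟨l', h1, n', h2, h3⟩
          obtain ⟨rfl, rfl⟩ := List.cons.inj h3
          refine ⟨h1.1, h1.2, ?_⟩
          rcases h2 with h2 | h2
          · exact Or.inl ⟨h2.1, by omega, h2.2.1, fun _ => h2.2.2⟩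
          · exact Or.inr ⟨by omega, fun _ => h2.1, by omega, h2.2⟩
    · intro l _ n _
      simp only [admissibleTerm, if_true, Nat.sub_self]
      ring
  | succ u ih =>
    obtain ⟨h1, h2, h3, h4⟩ := headFrac_le_fullFrac (fun k => f (k + 1)) (t - 1) u
    have ih := fun N M => ih (fun k => f (k + 1)) (t - 1) N M (by omega)
    rw [headFrac]
    simp only [fullFrac]
    set s := (headFrac (fun k => f (k + 1)) (u + 1)).1 with hs
    set r := (headFrac (fun k => f (k + 1)) (u + 1)).2 with hr
    set p' := (fullFrac (fun k => f (k + 1)) (t - 1) (u + 1)).1 with hp'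
    set p := (fullFrac (fun k => f (k + 1)) (t - 1) (u + 1)).2 with hp
    have hR := sumsTo_genFun_rows (a := s) (b := (p' : ℤ) - s) (α := r) (β := (p : ℤ) - r)
      (by omega) (by omega) (by omega) (by omega) (by omega) (by omega) (u := u + 1 + 1) (by omega)
      (f 1) N M
    rw [show (((f 1 * p' + p : ℕ) : ℤ) - ((f 1 * s + r : ℕ) : ℤ)) =
      f 1 * ((p' : ℤ) - s) + ((p : ℤ) - r) by push_cast; ring,
      show ((f 1 * s + r : ℕ) : ℤ) = f 1 * s + r by push_cast; ring]
    refine SumsTo.cons (T := fun l => {n | Admissible (fun k => f (k + 1)) (t - 1) (u + 1)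
        (nextTop (u + 1 + 1) M N l) (nextWeight (u + 1 + 1) M N l) n})
      (H := fun l n => admissibleTerm (u + 1) (nextTop (u + 1 + 1) M N l)
        (nextWeight (u + 1 + 1) M N l) n) hR ?_ ?_ ?_
    · intro l hl
      rw [genFun_transpose _ _ (by omega) (by omega) (by omega) (by omega) (by omega) (by omega)]
      convert ih _ _ using 1
      simp [nextTop, nextWeight]
    · rintro (_ | ⟨l, n⟩)
      · simp [Admissible]
      · simp only [Set.mem_ofPred_eq, Admissible]
        constructor
        · rintro ⟨h1, h2, ⟨-, h3, -⟩ | ⟨-, -, -, h4⟩⟩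
          · omega
          · exact ⟨l, ⟨h1, h2⟩, n, h4, rfl⟩
        · rintro ⟨l', h1, n', h2, h3⟩
          obtain ⟨rfl, rfl⟩ := List.cons.inj h3
          exact ⟨h1.1, h1.2, Or.inr ⟨by omega, by omega, by omega, h2⟩⟩
    · intro l _ n _
      simp [admissibleTerm]

/-! ### Continued fractions -/

/-- The pair of integers with a given continued fraction. -/
def evalContFrac : List ℕ → ℕ × ℕ
  | [] => (1, 0)
  | c :: l => (c * (evalContFrac l).1 + (evalContFrac l).2, (evalContFrac l).1)

theorem evalContFrac_contFrac (s r : ℕ) (hs : 0 < s) (h : Nat.Coprime s r) :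
    evalContFrac (contFrac s r) = (s, r) := by
  induction r using Nat.strong_induction_on generalizing s with
  | _ r ih =>
  obtain _ | r := r
  · rw [contFrac, evalContFrac, (Nat.coprime_zero_right s).mp h]
  · rw [contFrac, evalContFrac, ih _ (Nat.mod_lt _ (Nat.succ_pos _)) _ (Nat.succ_pos _)
      (by
        change Nat.gcd (r + 1) (s % (r + 1)) = 1
        rw [Nat.gcd_comm, ← Nat.gcd_rec]
        exact h.symm)]
    simp only [Prod.mk.injEq, and_true]
    rw [mul_comm]
    exact Nat.div_add_mod s (r + 1)

/-- Only the values of the continued fractions enter the argument, so the identification of the two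
endings is harmless. -/
theorem evalContFrac_append_one (l : List ℕ) (e : ℕ) :
    evalContFrac (l ++ [e, 1]) = evalContFrac (l ++ [e + 1]) := by
  induction l with
  | nil => simp [evalContFrac]
  | cons c l ih => simp only [List.cons_append, evalContFrac, ih]

theorem IsContFrac.eval {l : List ℕ} {s r : ℕ} (h : IsContFrac l s r) :
    evalContFrac l = (s, r) := by
  obtain ⟨h1, h2, rfl | ⟨l', e, rfl, h3⟩⟩ := h
  · exact evalContFrac_contFrac s r h1 h2
  · rw [evalContFrac_append_one, ← h3, evalContFrac_contFrac s r h1 h2]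

theorem map_range'_succ (c : ℕ → ℕ) (m : ℕ) :
    (List.range' 1 (m + 1)).map c = c 1 :: (List.range' 1 m).map fun k => c (k + 1) := by
  refine List.ext_getElem (by simp) fun i h1 h2 => ?_
  obtain _ | i := i
  · simp
  · simp [add_comm]

theorem evalContFrac_tail (f : ℕ → ℕ) (t : ℕ) :
    evalContFrac ((List.range' 1 t).map f ++ [f (t + 1) + 2]) = tailFrac f t := by
  induction t generalizing f with
  | zero => simp [evalContFrac, tailFrac]
  | succ t ih =>
    rw [map_range'_succ, List.cons_append, evalContFrac, tailFrac,
      ih fun k => f (k + 1)]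

theorem tailFrac_congr {f g : ℕ → ℕ} (h : ∀ k, 1 ≤ k → f k = g k) (t : ℕ) :
    tailFrac f t = tailFrac g t := by
  induction t generalizing f g with
  | zero => simp only [tailFrac, h 1 le_rfl]
  | succ t ih => simp only [tailFrac, h 1 le_rfl, ih fun k _ => h (k + 1) (by omega)]

theorem fSeq_succ (c : ℕ → ℕ) (u d : ℕ) :
    (fun k => fSeq c (u + 2) d (k + 1)) = fSeq (fun k => c (k + 1)) (u + 1) d := by
  funext k
  unfold fSeq
  by_cases h1 : k < u + 1
  · rw [if_pos (by omega), if_pos h1]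
  by_cases h2 : k = u + 1
  · rw [if_neg (by omega), if_pos (by omega), if_neg h1, if_pos h2]
  by_cases h3 : k = u + 2
  · rw [if_neg (by omega), if_neg (by omega), if_pos (by omega), if_neg h1, if_neg h2, if_pos h3]
  · rw [if_neg (by omega), if_neg (by omega), if_neg (by omega), if_neg h1, if_neg h2, if_neg h3]
    congr 1
    omega

theorem evalContFrac_fSeq_head (c : ℕ → ℕ) (u d : ℕ) :
    evalContFrac ((List.range' 1 u).map c ++ [d]) = headFrac (fSeq c (u + 1) d) (u + 1) := by
  induction u generalizing c with
  | zero => simp [evalContFrac, headFrac, fSeq]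
  | succ u ih =>
    have h1 : fSeq c (u + 1 + 1) d 1 = c 1 := by simp [fSeq]
    rw [map_range'_succ, List.cons_append, evalContFrac, ih, ← fSeq_succ, ← h1]
    rfl

/-- The entries `d` and `c (u + 1) - d` occupy neighbouring places of `fSeq` and are added in
`fullFrac`, which restores the partial quotient; this is where `d ≤ c (u + 1)` is needed. -/
theorem evalContFrac_fSeq_full (c : ℕ → ℕ) (t u d : ℕ) (hut : u ≤ t) (hd : d ≤ c (u + 1)) :
    evalContFrac ((List.range' 1 t).map c ++ [c (t + 1) + 2]) =
      fullFrac (fSeq c (u + 1) d) (t + 1) (u + 1) := by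
  induction u generalizing c t with
  | zero =>
    simp only [zero_add, fullFrac, Nat.add_sub_cancel]
    obtain _ | t := t
    · simp only [tailFrac, fSeq, evalContFrac, List.range'_zero, List.map_nil, List.nil_append]
      simp at hd ⊢
      omega
    · rw [map_range'_succ, List.cons_append, evalContFrac,
        evalContFrac_tail fun k => c (k + 1)]
      simp only [tailFrac]
      have h : tailFrac (fun k => fSeq c 1 d (k + 1 + 1)) t = tailFrac (fun k => c (k + 1)) t := by
        refine tailFrac_congr (fun k hk => ?_) t
        unfold fSeq
        rw [if_neg (by omega), if_neg (by omega), if_neg (by omega), Nat.add_sub_cancel]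
      rw [h]
      simp only [fSeq, lt_irrefl, if_false, if_true, Nat.reduceAdd, Nat.reduceLT, Nat.reduceEqDiff,
        Prod.mk.injEq, and_true]
      rw [← add_assoc, ← add_mul]
      congr 2
      simp at hd
      omega
  | succ u ih =>
    obtain _ | t := t
    · omega
    rw [map_range'_succ, List.cons_append, evalContFrac, ih (fun k => c (k + 1)) t (by omega) hd,
      fullFrac, fSeq_succ, Nat.add_sub_cancel]
    simp [fSeq]

/-! ### Peeling off the first partition -/

theorem part_cons (l : List ℕ) (n : List (List ℕ)) (k i : ℕ) :
    part (l :: n) (k + 2) i = part n (k + 1) i := rfl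

theorem wt_cons (l : List ℕ) (n : List (List ℕ)) (k : ℕ) : wt (l :: n) (k + 2) = wt n (k + 1) :=
  rfl

theorem bounds_add_two (f : ℕ → ℕ) (u N M : ℕ) (n : List (List ℕ)) (j : ℕ) :
    bounds f u N M n (j + 2) =
      if j + 2 ≤ u then
        (if f (j + 1) = 0 then (bounds f u N M n (j + 1)).2 else part n (j + 1) (f (j + 1)),
          (bounds f u N M n (j + 1)).1 - wt n (j + 1))
      else if j + 2 = u + 1 then
        ((bounds f u N M n (j + 1)).1 - 1 - wt n (j + 1),
          (if f (j + 1) = 0 then (bounds f u N M n (j + 1)).2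
            else part n (j + 1) (f (j + 1))) + 1)
      else
        ((if f (j + 1) = 0 then (bounds f u N M n (j + 1)).2
            else part n (j + 1) (f (j + 1))) - 1,
          (bounds f u N M n (j + 1)).1 + 1 - wt n (j + 1)) := rfl

/-- The recursion looks back one row only, so the bounds of row two can serve as the initial box of
the remaining sequence. For `u = 0` the truncated `u - 1` is right, since all later rows follow the
third rule. -/
theorem bounds_cons {f : ℕ → ℕ} {u N M N' M' : ℕ} {l : List ℕ} {n : List (List ℕ)}
    (h : bounds f u N M (l :: n) 2 = ((M' : ℤ), (N' : ℤ))) (k : ℕ) :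
    bounds f u N M (l :: n) (k + 2) = bounds (fun k => f (k + 1)) (u - 1) N' M' n (k + 1) := by
  induction k with
  | zero => exact h
  | succ k ih =>
    rw [bounds_add_two f, bounds_add_two _ (u - 1), part_cons, wt_cons, ih]
    by_cases h1 : k + 1 + 2 ≤ u
    · simp only [if_pos h1, if_pos (show k + 2 ≤ u - 1 by omega)]
    by_cases h2 : k + 1 + 2 = u + 1
    · simp only [if_neg h1, if_pos h2, if_neg (show ¬ k + 2 ≤ u - 1 by omega),
        if_pos (show k + 2 = u - 1 + 1 by omega)]
    · simp only [if_neg h1, if_neg h2, if_neg (show ¬ k + 2 ≤ u - 1 by omega),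
        if_neg (show ¬ k + 2 = u - 1 + 1 by omega)]

theorem wBound_cons {f : ℕ → ℕ} {u N M N' M' : ℕ} {l : List ℕ} {n : List (List ℕ)}
    (h : bounds f u N M (l :: n) 2 = ((M' : ℤ), (N' : ℤ))) (k : ℕ) :
    wBound f u N M (l :: n) (k + 2) = wBound (fun k => f (k + 1)) (u - 1) N' M' n (k + 1) := by
  unfold wBound
  rw [bounds_cons h]

theorem entry_cons {f : ℕ → ℕ} {u N M N' M' : ℕ} {l : List ℕ} {n : List (List ℕ)}
    (h : bounds f u N M (l :: n) 2 = ((M' : ℤ), (N' : ℤ))) (k i : ℕ) :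
    entry f u N M (l :: n) (k + 2) i = entry (fun k => f (k + 1)) (u - 1) N' M' n (k + 1) i := by
  unfold entry
  rw [bounds_cons h, part_cons]

theorem rowLast_eq (N : ℕ) (l : List ℕ) : rowLast N l = (N :: l).getD l.length 0 := by
  induction l generalizing N with
  | nil => rfl
  | cons n l ih => rw [rowLast, ih]; rfl

theorem isRow_iff {N M : ℕ} {l : List ℕ} :
    IsRow N M l ↔ (∀ i < l.length, l.getD i 0 ≤ (N :: l).getD i 0) ∧ l.sum ≤ M := by
  induction l generalizing N M with
  | nil => simp [IsRow]
  | cons n l ih =>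
    rw [IsRow, ih]
    constructor
    · rintro ⟨h1, h2, h3, h4⟩
      refine ⟨fun i hi => ?_, by rw [List.sum_cons]; omega⟩
      obtain _ | i := i
      · exact h1
      · exact h3 i (by simpa using hi)
    · rintro ⟨h1, h2⟩
      rw [List.sum_cons] at h2
      exact ⟨h1 0 (by simp), by omega, fun i hi => h1 (i + 1) (by simpa using hi), by omega⟩

theorem entry_one (f : ℕ → ℕ) (u N M : ℕ) (l : List ℕ) (n : List (List ℕ)) (i : ℕ) :
    entry f u N M (l :: n) 1 i = ((N :: l).getD i 0 : ℕ) := by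
  obtain _ | i := i
  · rfl
  · rfl

theorem part_one (l : List ℕ) (n : List (List ℕ)) (i : ℕ) :
    part (l :: n) 1 (i + 1) = (l.getD i 0 : ℕ) := rfl

theorem wt_one (l : List ℕ) (n : List (List ℕ)) : wt (l :: n) 1 = (l.sum : ℕ) := rfl

theorem wBound_one (f : ℕ → ℕ) (u N M : ℕ) (n : List (List ℕ)) : wBound f u N M n 1 = M := rfl

/-- The hypotheses on weight and last part are what keeps the truncated subtractions in `nextTop`
and `nextWeight` equal to the integer ones. -/
theorem bounds_two {f : ℕ → ℕ} {u N M : ℕ} {l : List ℕ} (n : List (List ℕ))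
    (hl : l.length = f 1) (hM : l.sum ≤ M) (h1 : u = 1 → l.sum < M) (h0 : u = 0 → 0 < rowLast N l) :
    bounds f u N M (l :: n) 2 = ((nextWeight u M N l : ℤ), (nextTop u M N l : ℤ)) := by
  have hlast : (if f 1 = 0 then (N : ℤ) else part (l :: n) 1 (f 1)) = rowLast N l := by
    rw [rowLast_eq, hl]
    split_ifs with h
    · rw [h]; rfl
    · obtain ⟨m, hm⟩ := Nat.exists_eq_succ_of_ne_zero h
      rw [hm]; rfl
  rw [bounds]
  simp only [zero_add, bounds, hlast, wt_one]
  unfold nextWeight nextTop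
  generalize l.sum = m at *
  rcases (by omega : u = 0 ∨ u = 1 ∨ 2 ≤ u) with h | h | h
  · subst h
    have := h0 rfl
    simp
    omega
  · subst h
    have := h1 rfl
    simp
    omega
  · rw [if_pos h, if_neg (by omega), if_neg (by omega), if_neg (by omega), if_neg (by omega)]
    simp
    omega

/-- The conditions of `IsAdmissible`, in a form that makes sense for `u = 0` also. -/
structure IsAdmissibleFrom (f : ℕ → ℕ) (t u N M : ℕ) (n : List (List ℕ)) : Prop where
  one_le : 1 ≤ n.length
  le_length : u ≤ n.length
  length_le : n.length ≤ t + 1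
  row_length : ∀ k, 1 ≤ k → k ≤ n.length → (row n k).length = f k
  parts : ∀ k, 1 ≤ k → k ≤ n.length → ∀ i, 1 ≤ i → i ≤ f k →
    entry f u N M n k i ≤ entry f u N M n k (i - 1)
  wt_le : ∀ k, 1 ≤ k → k ≤ n.length → wt n k ≤ wBound f u N M n k
  wt_last : wt n n.length = wBound f u N M n n.length
  wt_lt : 1 ≤ u → u < n.length → wt n u < wBound f u N M n u
  pos : ∀ k, u < k → k < n.length → 0 < entry f u N M n k (f k)
  zero_last : n.length < t + 1 → entry f u N M n n.length (f n.length) = 0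

theorem isAdmissible_iff {f : ℕ → ℕ} {t u N M : ℕ} {n : List (List ℕ)} (hu : 1 ≤ u) :
    IsAdmissible f t u N M n ↔ IsAdmissibleFrom f t u N M n :=
  ⟨fun h => ⟨hu.trans h.1, h.1, h.2, h.3, h.4, h.5, h.6, fun _ => h.7, h.8, h.9⟩,
    fun h => ⟨h.2, h.3, h.4, h.5, h.6, h.7, h.8 hu, h.9, h.10⟩⟩

theorem isRow_first {f : ℕ → ℕ} {u N M : ℕ} {l : List ℕ} {n : List (List ℕ)}
    (hl : l.length = f 1) : IsRow N M l ↔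
      (∀ i, 1 ≤ i → i ≤ f 1 → entry f u N M (l :: n) 1 i ≤ entry f u N M (l :: n) 1 (i - 1)) ∧
        wt (l :: n) 1 ≤ wBound f u N M (l :: n) 1 := by
  rw [isRow_iff, wt_one, wBound_one, Nat.cast_le]
  simp only [entry_one, Nat.cast_le]
  refine and_congr_left fun _ => ⟨fun h i h1 h2 => ?_, fun h i hi => ?_⟩
  · obtain ⟨j, rfl⟩ := Nat.exists_eq_add_of_le' h1
    exact h j (by omega)
  · exact h (i + 1) (by omega) (by omega)

theorem entry_first_last {f : ℕ → ℕ} (u : ℕ) {N : ℕ} (M : ℕ) {l : List ℕ} (n : List (List ℕ))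
    (hl : l.length = f 1) : entry f u N M (l :: n) 1 (f 1) = rowLast N l := by
  rw [entry_one, rowLast_eq, hl]

theorem isAdmissibleFrom_singleton {f : ℕ → ℕ} {t u N M : ℕ} {l : List ℕ} :
    IsAdmissibleFrom f t u N M [l] ↔
      l.length = f 1 ∧ IsRow N M l ∧ u ≤ 1 ∧ l.sum = M ∧ (0 < t → rowLast N l = 0) := by
  constructor
  · intro h
    have hl : l.length = f 1 := h.row_length 1 le_rfl le_rfl
    refine ⟨hl, (isRow_first hl).mpr ⟨h.parts 1 le_rfl le_rfl, h.wt_le 1 le_rfl le_rfl⟩,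
      h.le_length, ?_, fun ht => ?_⟩
    · have := h.wt_last
      rw [List.length_singleton, wt_one, wBound_one] at this
      exact_mod_cast this
    · have := h.zero_last (by simpa using ht)
      rw [List.length_singleton, entry_first_last u M [] hl] at this
      exact_mod_cast this
  · rintro ⟨hl, hr, hu, hs, ht⟩
    have hr := (isRow_first (f := f) (u := u) (n := []) hl).mp hr
    have hone : ∀ k, 1 ≤ k → k ≤ [l].length → k = 1 := fun k h1 h2 => le_antisymm h2 h1
    refine ⟨le_rfl, hu, by simp, ?_, ?_, ?_, ?_, ?_, ?_, ?_⟩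
    · intro k h1 h2
      rw [hone k h1 h2]
      exact hl
    · intro k h1 h2
      rw [hone k h1 h2]
      exact hr.1
    · intro k h1 h2
      rw [hone k h1 h2]
      exact hr.2
    · rw [List.length_singleton, wt_one, wBound_one, hs]
    · intro h1 h2
      rw [List.length_singleton] at h2
      omega
    · intro k h1 h2
      rw [List.length_singleton] at h2
      omega
    · intro h
      rw [List.length_singleton] at h ⊢
      rw [entry_first_last u M [] hl, ht (by omega), Nat.cast_zero]

theorem isAdmissibleFrom_cons {f : ℕ → ℕ} {t u N M : ℕ} {l : List ℕ} {n : List (List ℕ)}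
    (hn : 1 ≤ n.length) : IsAdmissibleFrom f t u N M (l :: n) ↔
      l.length = f 1 ∧ IsRow N M l ∧ 0 < t ∧ (u = 1 → l.sum < M) ∧ (u = 0 → 0 < rowLast N l) ∧
        IsAdmissibleFrom (fun k => f (k + 1)) (t - 1) (u - 1) (nextTop u M N l)
          (nextWeight u M N l) n := by
  have hlen : (l :: n).length = n.length + 1 := rfl
  obtain ⟨m, hm⟩ := Nat.exists_eq_add_of_le' hn
  have hsplit : ∀ k, 1 ≤ k → k = 1 ∨ ∃ j, k = j + 2 := by
    intro k hk
    rcases eq_or_lt_of_le hk with h | h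
    · exact Or.inl h.symm
    · exact Or.inr ⟨k - 2, by omega⟩
  constructor
  · intro h
    have hl : l.length = f 1 := h.row_length 1 le_rfl h.one_le
    have hr : IsRow N M l :=
      (isRow_first hl).mpr ⟨h.parts 1 le_rfl h.one_le, h.wt_le 1 le_rfl h.one_le⟩
    have h1 : u = 1 → l.sum < M := by
      rintro rfl
      have := h.wt_lt le_rfl (by omega)
      rw [wt_one, wBound_one] at this
      exact_mod_cast this
    have h0 : u = 0 → 0 < rowLast N l := by
      rintro rfl
      have := h.pos 1 (by omega) (by omega)
      rw [entry_first_last 0 M n hl] at this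
      exact_mod_cast this
    have hb := bounds_two n hl hr.sum_le h1 h0
    have hlen' := h.length_le
    refine ⟨hl, hr, by omega, h1, h0, hn, ?_, by omega, ?_, ?_, ?_, ?_, ?_, ?_, ?_⟩
    · have := h.le_length
      omega
    · intro k hk1 hk2
      obtain ⟨j, rfl⟩ := Nat.exists_eq_add_of_le' hk1
      exact h.row_length (j + 2) (by omega) (by omega)
    · intro k hk1 hk2
      obtain ⟨j, rfl⟩ := Nat.exists_eq_add_of_le' hk1
      have := h.parts (j + 2) (by omega) (by omega)
      simpa only [entry_cons hb] using this
    · intro k hk1 hk2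
      obtain ⟨j, rfl⟩ := Nat.exists_eq_add_of_le' hk1
      have := h.wt_le (j + 2) (by omega) (by omega)
      rwa [wt_cons, wBound_cons hb] at this
    · have := h.wt_last
      rw [hlen, hm, wt_cons, wBound_cons hb] at this
      rwa [hm]
    · intro hu1 hu2
      obtain ⟨j, rfl⟩ := Nat.exists_eq_add_of_le' (show 2 ≤ u by omega)
      have := h.wt_lt (by omega) (by omega)
      rwa [wt_cons, wBound_cons hb] at this
    · intro k hk1 hk2
      obtain ⟨j, rfl⟩ := Nat.exists_eq_add_of_le' (show 1 ≤ k by omega)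
      have := h.pos (j + 2) (by omega) (by omega)
      rwa [entry_cons hb] at this
    · intro ht
      have := h.zero_last (by omega)
      rw [hlen, hm, entry_cons hb] at this
      rwa [hm]
  · rintro ⟨hl, hr, ht, h1, h0, h⟩
    have hb := bounds_two n hl hr.sum_le h1 h0
    have hr' := (isRow_first (f := f) (u := u) (n := n) hl).mp hr
    have hlen' := h.length_le
    refine ⟨by omega, ?_, by omega, ?_, ?_, ?_, ?_, ?_, ?_, ?_⟩
    · have := h.le_length
      omega
    · intro k hk1 hk2
      obtain rfl | ⟨j, rfl⟩ := hsplit k hk1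
      · exact hl
      · exact h.row_length (j + 1) (by omega) (by omega)
    · intro k hk1 hk2
      obtain rfl | ⟨j, rfl⟩ := hsplit k hk1
      · exact hr'.1
      · simp only [entry_cons hb]
        exact h.parts (j + 1) (by omega) (by omega)
    · intro k hk1 hk2
      obtain rfl | ⟨j, rfl⟩ := hsplit k hk1
      · exact hr'.2
      · rw [wt_cons, wBound_cons hb]
        exact h.wt_le (j + 1) (by omega) (by omega)
    · rw [hlen, hm, wt_cons, wBound_cons hb, ← hm]
      exact h.wt_last
    · intro hu1 hu2
      obtain rfl | ⟨j, rfl⟩ := hsplit u hu1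
      · rw [wt_one, wBound_one]
        exact_mod_cast h1 rfl
      · rw [wt_cons, wBound_cons hb]
        exact h.wt_lt (by omega) (by omega)
    · intro k hk1 hk2
      obtain rfl | ⟨j, rfl⟩ := hsplit k (by omega)
      · rw [entry_first_last u M n hl]
        exact_mod_cast h0 (by omega)
      · rw [entry_cons hb]
        exact h.pos (j + 1) (by omega) (by omega)
    · intro ht'
      rw [hlen, hm, entry_cons hb, ← hm]
      exact h.zero_last (by omega)

theorem admissible_iff {f : ℕ → ℕ} {t u N M : ℕ} {n : List (List ℕ)} :
    IsAdmissibleFrom f t u N M n ↔ Admissible f t u N M n := by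
  induction n generalizing f t u N M with
  | nil => exact ⟨fun h => absurd h.one_le (by simp), False.elim⟩
  | cons l n ih =>
    rw [Admissible]
    obtain _ | ⟨l', n⟩ := n
    · rw [isAdmissibleFrom_singleton]
      simp [Admissible]
    · rw [isAdmissibleFrom_cons (by simp), ih]
      simp

/-! ### The summand -/

/-- The contribution of one partition to the summand of the fermionic sum. -/
def rowFactor (f : ℕ → ℕ) (u N M : ℕ) (n : List (List ℕ)) (k : ℕ) : RatFunc ℚ :=
  q ^ (∑ i ∈ Finset.Icc 1 (f k), stepExp (u + 1 - k) (part n k i)) *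
    ∏ i ∈ Finset.Icc 1 (f k),
      gauss
        (2 * (wBound f u N M n k - ∑ j ∈ Finset.Icc 1 i, part n k j)
          + entry f u N M n k (i - 1) + entry f u N M n k i)
        (entry f u N M n k (i - 1) - entry f u N M n k i)

/-- The truncated `u + 1 - k` is zero exactly for `k > u`, so it selects the right exponent and
survives the simultaneous shift of `u` and `k`. -/
theorem rowFactor_cons {f : ℕ → ℕ} {u N M N' M' : ℕ} {l : List ℕ} {n : List (List ℕ)}
    (h : bounds f u N M (l :: n) 2 = ((M' : ℤ), (N' : ℤ))) (k : ℕ) :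
    rowFactor f u N M (l :: n) (k + 2) =
      rowFactor (fun k => f (k + 1)) (u - 1) N' M' n (k + 1) := by
  unfold rowFactor
  simp only [entry_cons h, wBound_cons h, part_cons]
  rw [show u + 1 - (k + 2) = u - 1 + 1 - (k + 1) by omega]

theorem prod_Icc_one {R : Type*} [CommMonoid R] (m : ℕ) (g : ℕ → R) :
    ∏ i ∈ Finset.Icc 1 m, g i = ∏ i ∈ Finset.range m, g (i + 1) := by
  induction m with
  | zero => simp
  | succ m ih => rw [Finset.prod_Icc_succ_top (by omega), ih, Finset.prod_range_succ]

theorem sum_Icc_one {R : Type*} [AddCommMonoid R] (m : ℕ) (g : ℕ → R) :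
    ∑ i ∈ Finset.Icc 1 m, g i = ∑ i ∈ Finset.range m, g (i + 1) := by
  induction m with
  | zero => simp
  | succ m ih => rw [Finset.sum_Icc_succ_top (by omega), ih, Finset.sum_range_succ]

theorem rowTerm_eq (e : ℤ → ℤ) {N M : ℕ} {l : List ℕ} (h : IsRow N M l) :
    rowTerm e N M l = q ^ (∑ i ∈ Finset.range l.length, e (l.getD i 0 : ℕ)) *
      ∏ i ∈ Finset.range l.length,
        gauss (2 * ((M : ℤ) - ∑ j ∈ Finset.range (i + 1), ((l.getD j 0 : ℕ) : ℤ)) +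
          ((N :: l).getD i 0 : ℕ) + (l.getD i 0 : ℕ))
          ((((N :: l).getD i 0 : ℕ) : ℤ) - (l.getD i 0 : ℕ)) := by
  induction l generalizing N M with
  | nil => simp [rowTerm]
  | cons n l ih =>
    rw [rowTerm, ih h.2.2, List.length_cons, Finset.sum_range_succ', Finset.prod_range_succ',
      zpow_add₀ q_ne_zero]
    simp only [List.getD_cons_succ, List.getD_cons_zero, Finset.sum_range_succ', zero_add,
      Finset.range_zero, Finset.sum_empty, Nat.cast_sub h.2.1]
    have : ∀ x : ℤ, (M : ℤ) - n - x = M - (x + n) := fun x => by ring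
    simp only [this]
    ring

theorem rowFactor_one {f : ℕ → ℕ} (u : ℕ) {N M : ℕ} {l : List ℕ} (n : List (List ℕ))
    (hl : l.length = f 1) (h : IsRow N M l) :
    rowFactor f u N M (l :: n) 1 = rowTerm (stepExp u) N M l := by
  rw [rowTerm_eq _ h, hl, rowFactor, prod_Icc_one, sum_Icc_one]
  simp only [entry_one, part_one, wBound_one, sum_Icc_one, Nat.add_sub_cancel,
    List.getD_cons_succ]

/-- The condition `1 ≤ f u` reflects `d ≥ 1`: for an empty row `u`, `part` would return the default
`0`, whereas `rowLast` returns the upper bound of the row. -/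
theorem admissibleTerm_eq {f : ℕ → ℕ} {t u N M : ℕ} {n : List (List ℕ)}
    (h : Admissible f t u N M n) (hf : 1 ≤ u → 1 ≤ f u) :
    admissibleTerm u N M n = q ^ (if u = 0 then 0 else part n u (f u)) *
      ∏ k ∈ Finset.range n.length, rowFactor f u N M n (k + 1) := by
  induction n generalizing f t u N M with
  | nil => exact h.elim
  | cons l n ih =>
    obtain ⟨hl, hr, h⟩ := h
    have hpart : u = 1 → part (l :: n) u (f u) = rowLast N l := by
      rintro rfl
      obtain ⟨m, hm⟩ := Nat.exists_eq_add_of_le' (hf le_rfl)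
      rw [rowLast_eq, hl, hm]
      rfl
    rw [List.length_cons, Finset.prod_range_succ', zero_add, rowFactor_one u n hl hr,
      admissibleTerm]
    rcases h with ⟨rfl, hu, -⟩ | ⟨-, h1, h0, h⟩
    · simp only [admissibleTerm, List.length_nil, Finset.range_zero, Finset.prod_empty]
      rcases (by omega : u = 0 ∨ u = 1) with rfl | rfl
      · simp
      · simp [hpart rfl]
    · have hb := bounds_two n hl hr.sum_le h1 h0
      rw [ih h fun hu => by
        have := hf (by omega)
        change 1 ≤ f (u - 1 + 1)
        rwa [Nat.sub_add_cancel (by omega)]]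
      simp only [rowFactor_cons hb]
      rcases (by omega : u = 0 ∨ u = 1 ∨ 2 ≤ u) with rfl | rfl | hu
      · simp; ring
      · simp [hpart rfl]; ring
      · obtain ⟨v, rfl⟩ := Nat.exists_eq_add_of_le' hu
        simp only [if_false, part_cons,
          show v + 2 - 1 = v + 1 by omega, Nat.add_one_ne_zero, show v + 2 ≠ 1 by omega]
        ring

theorem fermiTerm_eq {f : ℕ → ℕ} {t u d N M : ℕ} {n : List (List ℕ)} (hu : 1 ≤ u)
    (hd : f u = d) (hd1 : 1 ≤ d) (h : IsAdmissible f t u N M n) :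
    fermiTerm f u d N M n = admissibleTerm u N M n := by
  have hlen := h.le_length
  rw [admissibleTerm_eq (admissible_iff.mp ((isAdmissible_iff hu).mp h)) (by omega),
    if_neg (by omega), ← prod_Icc_one n.length (rowFactor f u N M n)]
  unfold rowFactor
  rw [Finset.prod_mul_distrib, fermiTerm, ← mul_assoc, hd]
  congr 1
  have hq : ∀ (s : Finset ℕ) (g : ℕ → ℤ), ∏ k ∈ s, q ^ g k = q ^ ∑ k ∈ s, g k := by
    intro s g
    classical
    induction s using Finset.induction_on with
    | empty => simp
    | insert a s ha ih => rw [Finset.prod_insert ha, Finset.sum_insert ha, ih,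
        zpow_add₀ q_ne_zero]
  rw [hq, ← zpow_add₀ q_ne_zero, fermiExponent, add_assoc]
  congr 2
  have hunion : Finset.Icc 1 n.length = Finset.Icc 1 u ∪ Finset.Icc (u + 1) n.length := by
    ext k
    simp only [Finset.mem_union, Finset.mem_Icc]
    omega
  rw [hunion, Finset.sum_union]
  · congr 1
    · refine Finset.sum_congr rfl fun k hk => Finset.sum_congr rfl fun i _ => ?_
      rw [Finset.mem_Icc] at hk
      rw [stepExp, if_neg (by omega)]
    · refine Finset.sum_congr rfl fun k hk => Finset.sum_congr rfl fun i _ => ?_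
      rw [Finset.mem_Icc] at hk
      rw [stepExp, if_pos (by omega)]
  · rw [Finset.disjoint_left]
    intro k hk hk'
    rw [Finset.mem_Icc] at hk hk'
    omega

end BurgeTree

end

/-! ### The theorem -/

theorem mainTheorem1 (p p' : ℕ) (hp : 0 < p) (hp' : 0 < p') (hpp' : Nat.Coprime p p')
    (t : ℕ) (ht : 1 ≤ t) (c : ℕ → ℕ)
    (hc : BurgeTree.IsContFrac ((List.range' 1 (t - 1)).map c ++ [c t + 2]) p' p)
    (u d : ℕ) (hu : 1 ≤ u) (hut : u ≤ t) (hd : 1 ≤ d) (hdc : d ≤ c u)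
    (r s : ℕ) (hrs : BurgeTree.IsContFrac ((List.range' 1 (u - 1)).map c ++ [d]) s r)
    (N M : ℕ) :
    {n | BurgeTree.IsAdmissible (BurgeTree.fSeq c u d) t u N M n}.Finite ∧
    BurgeTree.genFun N M r ((p : ℤ) - r) s ((p' : ℤ) - s) =
      ∑ᶠ n ∈ {n | BurgeTree.IsAdmissible (BurgeTree.fSeq c u d) t u N M n},
        BurgeTree.fermiTerm (BurgeTree.fSeq c u d) u d N M n := by
  obtain ⟨t, rfl⟩ := Nat.exists_eq_add_of_le' ht
  obtain ⟨u, rfl⟩ := Nat.exists_eq_add_of_le' hu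
  have h1 := hc.eval
  have h2 := hrs.eval
  rw [Nat.add_sub_cancel] at h1 h2
  rw [BurgeTree.evalContFrac_fSeq_full c t u d (by omega) hdc] at h1
  rw [BurgeTree.evalContFrac_fSeq_head] at h2
  have key := BurgeTree.sumsTo_genFun (BurgeTree.fSeq c (u + 1) d) (t + 1) u N M (by omega)
  rw [h1, h2] at key
  have hset : {n | BurgeTree.IsAdmissible (BurgeTree.fSeq c (u + 1) d) (t + 1) (u + 1) N M n} =
      {n | BurgeTree.Admissible (BurgeTree.fSeq c (u + 1) d) (t + 1) (u + 1) N M n} := by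
    ext n
    exact (BurgeTree.isAdmissible_iff hu).trans BurgeTree.admissible_iff
  refine ⟨hset ▸ key.1, ?_⟩
  rw [← key.2, ← hset]
  refine finsum_mem_congr rfl fun n hn => ?_
  exact (BurgeTree.fermiTerm_eq hu (by simp [BurgeTree.fSeq]) hd hn).symm
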